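/- Let $\mathcal{A}$ be a real central hyperplane arrangement, i.e. a finite set of linear hyperplanes in $\mathbb{R}^d$. Its chambers are the connected components of $\mathbb{R}^d\setminus\bigcup_{H\in\mathcal{A}}H$, and its tope graph $\mathcal{T}(\mathcal{A})$ is the graph whose vertices are the chambers, two chambers being adjacent if exactly one hyperplane of $\mathcal{A}$ separates them. Let $d(C,D)$ denote the shortest-path distance in $\mathcal{T}(\mathcal{A})$, let $Z=[q^{d(C,D)}]_{C,D}$ be the matrix indexed by the chambers, and let $\mathrm{Mag}(\mathcal{A},q)\in\mathbb{Q}(q)$ be the sum of all entries of $Z^{-1}$. Write $\mathrm{Mag}(\mathcal{A},q)=P(q)/Q(q)$ in reduced form, i.e. with coprime polynomials $P,Q\in\mathbb{Q}[q]$, $Q\neq0$, where the leading coefficient of $Q$ is positive. Then $P\neq 0$ and: 1. $\#\mathcal{A}=\deg Q-\deg P$. 2. $P$ and $Q$ are palindromic, i.e. $q^{\deg P}P(q^{-1})=P(q)$ and $q^{\deg Q}Q(q^{-1})=Q(q)$. 3. All complex roots of $Q$ are roots of unity other than $1$. -/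

import Mathlib

noncomputable section

/-! ### Magnitude of a finite graph -/

namespace SimpleGraph

variable {V : Type*}

open Classical in
/-- The zeta matrix `[q ^ d(x, y)]` of a graph, where `d` is the shortest-path distance and
`q ^ ∞ = 0` by convention. Its entries lie in the field `ℚ(q)`; the variable `q` is
`RatFunc.X`. -/
def zetaMatrix (G : SimpleGraph V) : Matrix V V (RatFunc ℚ) :=
  Matrix.of fun x y => if G.Reachable x y then (RatFunc.X : RatFunc ℚ) ^ G.dist x y else 0

open Classical in
/-- The magnitude of a finite graph: the sum of all entries of the inverse of its zeta matrix.
(The determinant of the zeta matrix is a polynomial with constant term `1`, so that the inverse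
exists.) -/
def magnitude [Fintype V] (G : SimpleGraph V) : RatFunc ℚ :=
  ∑ x, ∑ y, (G.zetaMatrix)⁻¹ x y

end SimpleGraph

/-! ### Real central hyperplane arrangements -/

/-- A real central hyperplane arrangement: a finite set of linear hyperplanes of `ℝ ^ d`. -/
structure CentralArrangement (d : ℕ) where
  /-- The hyperplanes of the arrangement. -/
  hyperplanes : Finset (Submodule ℝ (EuclideanSpace ℝ (Fin d)))
  /-- Each of them is a linear subspace of codimension one. -/
  finrank_add_one : ∀ H ∈ hyperplanes, Module.finrank ℝ H + 1 = d

namespace CentralArrangement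

variable {d : ℕ}

/-- The complement in `ℝ ^ d` of the union of the hyperplanes. -/
def complement (A : CentralArrangement d) : Set (EuclideanSpace ℝ (Fin d)) :=
  {x | ∀ H ∈ A.hyperplanes, x ∉ H}

/-- The chambers: the connected components of the complement, as subsets of `ℝ ^ d`. -/
def chambers (A : CentralArrangement d) : Set (Set (EuclideanSpace ℝ (Fin d))) :=
  {C | ∃ x ∈ A.complement, C = connectedComponentIn A.complement x}

/-- The hyperplane `H` separates the sets `C` and `D`: they lie in the two different open half
spaces bounded by `H`. -/
def Separates (H : Submodule ℝ (EuclideanSpace ℝ (Fin d)))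
    (C D : Set (EuclideanSpace ℝ (Fin d))) : Prop :=
  ∃ α : Module.Dual ℝ (EuclideanSpace ℝ (Fin d)),
    LinearMap.ker α = H ∧ (∀ x ∈ C, 0 < α x) ∧ (∀ x ∈ D, α x < 0)

theorem Separates.symm {H : Submodule ℝ (EuclideanSpace ℝ (Fin d))}
    {C D : Set (EuclideanSpace ℝ (Fin d))} (h : Separates H C D) : Separates H D C := by
  obtain ⟨α, hα, hC, hD⟩ := h
  refine ⟨-α, ?_, fun x hx => ?_, fun x hx => ?_⟩
  · rw [← hα]; ext x; simp
  · simpa using hD x hx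
  · simpa using hC x hx

/-- The set `S(C, D)` of the hyperplanes of the arrangement that separate `C` and `D`. -/
def separating (A : CentralArrangement d) (C D : Set (EuclideanSpace ℝ (Fin d))) :
    Set (Submodule ℝ (EuclideanSpace ℝ (Fin d))) :=
  {H | H ∈ A.hyperplanes ∧ Separates H C D}

/-- The tope graph: the vertices are the chambers, and two chambers are adjacent if exactly one
hyperplane separates them. -/
def topeGraph (A : CentralArrangement d) : SimpleGraph A.chambers where
  Adj C D := ∃ H, A.separating C D = {H}
  symm := by
    constructor
    rintro C D ⟨H, hH⟩
    refine ⟨H, ?_⟩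
    rw [← hH]
    ext K
    exact ⟨fun h => ⟨h.1, h.2.symm⟩, fun h => ⟨h.1, h.2.symm⟩⟩
  loopless := by
    constructor
    rintro ⟨C, x, hx, rfl⟩ ⟨H, hH⟩
    have hmem : H ∈ A.separating (connectedComponentIn A.complement x)
        (connectedComponentIn A.complement x) := by rw [hH]; rfl
    obtain ⟨-, α, -, h1, h2⟩ := hmem
    have hxC := mem_connectedComponentIn hx
    exact lt_asymm (h1 x hxC) (h2 x hxC)

/-- Every hyperplane is the kernel of a linear form. -/
theorem exists_ker_eq (A : CentralArrangement d) (H : A.hyperplanes) :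
    ∃ α : Module.Dual ℝ (EuclideanSpace ℝ (Fin d)), LinearMap.ker α = H.1 := by
  have hfin := A.finrank_add_one H.1 H.2
  have hne : H.1 ≠ ⊤ := by
    intro h
    rw [h] at hfin
    simp at hfin
  obtain ⟨α, hα, hle⟩ := Submodule.exists_le_ker_of_lt_top H.1 (lt_top_iff_ne_top.2 hne)
  refine ⟨α, (Submodule.eq_of_le_of_finrank_eq hle ?_).symm⟩
  have h1 := Module.Dual.finrank_ker_add_one_of_ne_zero hα
  simp at h1
  omega

/-- There are only finitely many chambers. -/
instance finite_chambers (A : CentralArrangement d) : Finite A.chambers := by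
  choose α hα using A.exists_ker_eq
  choose p hp hC using fun C : A.chambers => C.2
  refine Finite.of_injective
    (fun (C : A.chambers) (H : A.hyperplanes) => decide (0 < α H (p C))) ?_
  intro C D hCD
  apply Subtype.ext
  rw [hC C, hC D]
  refine connectedComponentIn_eq ?_
  refine (convex_segment (p C) (p D)).isPreconnected.subset_connectedComponentIn
    (left_mem_segment ℝ _ _) ?_ (right_mem_segment ℝ _ _)
  rintro z ⟨a, b, ha, hb, hab, rfl⟩ H hH hz
  have hker : LinearMap.ker (α ⟨H, hH⟩) = H := hα ⟨H, hH⟩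
  have hne : ∀ E : A.chambers, α ⟨H, hH⟩ (p E) ≠ 0 := fun E h0 =>
    hp E H hH (hker ▸ (LinearMap.mem_ker.2 h0))
  have hz0 : a * α ⟨H, hH⟩ (p C) + b * α ⟨H, hH⟩ (p D) = 0 := by
    have hz' : a • p C + b • p D ∈ LinearMap.ker (α ⟨H, hH⟩) := hker.symm ▸ hz
    simpa using hz'
  have hs := congrFun hCD ⟨H, hH⟩
  simp only [decide_eq_decide] at hs
  have hpos : 0 < a ∨ 0 < b := by
    by_contra! h
    linarith [h.1, h.2]
  rcases lt_or_gt_of_ne (hne C) with h | h <;> rcases lt_or_gt_of_ne (hne D) with h' | h'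
  · rcases hpos with h0 | h0
    · nlinarith [mul_neg_of_pos_of_neg h0 h, mul_nonneg hb (neg_nonneg.2 h'.le)]
    · nlinarith [mul_neg_of_pos_of_neg h0 h', mul_nonneg ha (neg_nonneg.2 h.le)]
  · exact lt_asymm h (hs.2 h')
  · exact lt_asymm h' (hs.1 h)
  · rcases hpos with h0 | h0
    · nlinarith [mul_pos h0 h, mul_nonneg hb h'.le]
    · nlinarith [mul_pos h0 h', mul_nonneg ha h.le]

instance fintypeChambers (A : CentralArrangement d) : Fintype A.chambers :=
  Fintype.ofFinite _

/-- The magnitude `Mag(A, q)` of an arrangement: the magnitude of its tope graph. -/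
def magnitude (A : CentralArrangement d) : RatFunc ℚ :=
  A.topeGraph.magnitude

end CentralArrangement

end

/-! ### Sign vectors, faces, and signed face counts under adding a hyperplane. -/

section SignVectors

open SignType Filter Topology

variable {V ι : Type*} [AddCommGroup V] [Module ℝ V]

/-! The path distance between two chambers is the number n(C, E) of hyperplanes separating them
(`topeGraph_dist`), so Z has entries q ^ n(C, E). Let D = det Z and let S be the sum of the entries
of the adjugate of Z. Both are polynomials and Mag = S / D, so Q divides D. At q = 0 the matrix is
the identity, hence neither P nor Q vanishes at 0. Write n for the number of hyperplanes.

Palindromicity and degrees: n(C, E) + n(C, -E) = n. If w is the weighting at q, i.e. Z w = 1, then C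
↦ q ^ n * w(-C) is a weighting at 1 / q, so Mag(1 / q) = q ^ n * Mag(q). For a reduced fraction this
gives the degree difference and determines the reversals of P and Q up to a common constant, which
is 1 because Q(1) ≠ 0 (`palindromic_of_functional_equation`).

No pole at 1: for 0 < q < 1 the quadratic form of Z satisfies vᵀ Z v ≥ q ^ n * (∑ v) ^ 2
(`pow_card_mul_sq_le`). For v the weighting this reads Mag ≥ q ^ n * Mag ^ 2, so Mag stays bounded
near 1.

Roots of unity: if q is not a root of unity, Z is nonsingular (`eq_zero_of_sum_signDist_eq_zero`),
by induction on the set of hyperplanes. Let Z w = 0. Localizing at a nonzero face F, that is,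
keeping the hyperplanes through F, turns w into kernel vectors of a smaller arrangement; hence the
sum of q ^ n(C, E) * w(E) over the chambers E with F ∘ E = C vanishes. Witt's identity
(`wittSum_eq`) evaluates the alternating count of the faces F with F ∘ E = C: it is ±1 if C = -E and
0 otherwise. Together they leave w(C) = ± q ^ n * w(-C), and using this twice gives (q ^ (2 * n) -
1) * w(C) = 0. -/

theorem eventually_sign_add_smul (β : Module.Dual ℝ V) (x y : V) :
    ∀ᶠ ε in 𝓝[>] (0 : ℝ), sign (β (x + ε • y)) =
      if sign (β x) = 0 then sign (β y) else sign (β x) := by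
  by_cases h : β x = 0
  · filter_upwards [self_mem_nhdsWithin] with ε hε
    have hε' : (0 : ℝ) < ε := hε
    simp [h, sign_mul, sign_pos hε']
  · have h1 : Tendsto (fun ε : ℝ => β x + ε * β y) (𝓝[>] 0) (𝓝 (β x)) := by
      have : Continuous fun ε : ℝ => β x + ε * β y := by fun_prop
      have h2 := this.tendsto 0
      simp only [zero_mul, add_zero] at h2
      exact h2.mono_left nhdsWithin_le_nhds
    have h2 := (continuousAt_sign_of_ne_zero h).tendsto.comp h1
    rw [nhds_discrete, tendsto_pure] at h2
    filter_upwards [h2] with ε hε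
    simpa [sign_eq_zero_iff, h] using hε

/-- Composition of covectors is realizable. -/
theorem exists_sign_comp (α : ι → Module.Dual ℝ V) (s : Finset ι) (x y : V) :
    ∃ z, ∀ j ∈ s, sign (α j z) = if sign (α j x) = 0 then sign (α j y) else sign (α j x) := by
  have h : ∀ᶠ ε in 𝓝[>] (0 : ℝ), ∀ j ∈ s, sign (α j (x + ε • y)) =
      if sign (α j x) = 0 then sign (α j y) else sign (α j x) :=
    (eventually_all_finset s).2 fun j _ => eventually_sign_add_smul (α j) x y
  obtain ⟨ε, hε⟩ := h.exists
  exact ⟨_, hε⟩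

open Classical in
/-- The sign vector of `x` with respect to the forms indexed by `s`, extended by zero. -/
noncomputable def signVec (α : ι → Module.Dual ℝ V) (s : Finset ι) (x : V) : ι → SignType :=
  fun j => if j ∈ s then sign (α j x) else 0

open Classical in
/-- The covectors of the arrangement indexed by `s`, one for each face. -/
noncomputable def covectors [Fintype ι] (α : ι → Module.Dual ℝ V) (s : Finset ι) :
    Finset (ι → SignType) :=
  {F | ∃ x, signVec α s x = F}

/-- The linear span of the face with covector `F`. -/
noncomputable def zeroSpace (α : ι → Module.Dual ℝ V) (s : Finset ι) (F : ι → SignType) :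
    Submodule ℝ V :=
  ⨅ j ∈ s, ⨅ _ : F j = 0, LinearMap.ker (α j)

/-- The parity of the dimension of the face with covector `F`. -/
noncomputable def faceSign (α : ι → Module.Dual ℝ V) (s : Finset ι) (F : ι → SignType) : ℤ :=
  (-1) ^ Module.finrank ℝ (zeroSpace α s F)

theorem mem_zeroSpace {α : ι → Module.Dual ℝ V} {s : Finset ι} {F : ι → SignType} {u : V} :
    u ∈ zeroSpace α s F ↔ ∀ j ∈ s, F j = 0 → α j u = 0 := by
  simp [zeroSpace]

theorem signVec_eq_iff {α : ι → Module.Dual ℝ V} {s : Finset ι} {F : ι → SignType} {x : V} :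
    signVec α s x = F ↔ (∀ j ∈ s, sign (α j x) = F j) ∧ ∀ j ∉ s, F j = 0 := by
  constructor
  · rintro rfl
    exact ⟨fun j hj => by simp [signVec, hj], fun j hj => by simp [signVec, hj]⟩
  · rintro ⟨h1, h2⟩
    funext j
    by_cases hj : j ∈ s
    · simp [signVec, hj, h1 j hj]
    · simp [signVec, hj, h2 j hj]

theorem mem_zeroSpace_of_signVec {α : ι → Module.Dual ℝ V} {s : Finset ι} {F : ι → SignType}
    {x : V} (hx : ∀ j ∈ s, sign (α j x) = F j) : x ∈ zeroSpace α s F :=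
  mem_zeroSpace.2 fun j hj h0 => sign_eq_zero_iff.1 ((hx j hj).trans h0)

theorem finrank_inf_ker_add_one [FiniteDimensional ℝ V] (U : Submodule ℝ V)
    (β : Module.Dual ℝ V) (h : ¬ U ≤ LinearMap.ker β) :
    Module.finrank ℝ (U ⊓ LinearMap.ker β : Submodule ℝ V) + 1 = Module.finrank ℝ U := by
  have h1 : β.domRestrict U ≠ 0 := by
    intro h0
    refine h fun u hu => ?_
    simpa using LinearMap.congr_fun h0 ⟨u, hu⟩
  have h2 := Module.Dual.finrank_ker_add_one_of_ne_zero (f := β.domRestrict U) h1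
  have h3 : (LinearMap.ker (β.domRestrict U)).map U.subtype = U ⊓ LinearMap.ker β := by
    ext v
    simp [Submodule.mem_map, LinearMap.mem_ker, and_comm]
  rw [← h3, Submodule.finrank_map_subtype_eq]
  exact h2

theorem mem_covectors [Fintype ι] {α : ι → Module.Dual ℝ V} {s : Finset ι} {F : ι → SignType} :
    F ∈ covectors α s ↔ ∃ x, (∀ j ∈ s, sign (α j x) = F j) ∧ ∀ j ∉ s, F j = 0 := by
  simp [covectors, signVec_eq_iff]

section Deletion

variable [DecidableEq ι]

theorem update_mem_covectors [Fintype ι] {α : ι → Module.Dual ℝ V} {s : Finset ι} {i : ι}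
    (hi : i ∉ s)
    {F : ι → SignType} (hF : ∀ j ∉ s, F j = 0) (a : SignType) :
    Function.update F i a ∈ covectors α (insert i s) ↔
      ∃ x, (∀ j ∈ s, sign (α j x) = F j) ∧ sign (α i x) = a := by
  rw [mem_covectors]
  have hne : ∀ j ∈ s, j ≠ i := fun j hj h => hi (h ▸ hj)
  constructor
  · rintro ⟨x, hx, -⟩
    refine ⟨x, fun j hj => ?_, ?_⟩
    · rw [hx j (Finset.mem_insert_of_mem hj), Function.update_of_ne (hne j hj)]
    · rw [hx i (Finset.mem_insert_self _ _), Function.update_self]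
  · rintro ⟨x, hx, hxi⟩
    refine ⟨x, fun j hj => ?_, fun j hj => ?_⟩
    · rcases Finset.mem_insert.1 hj with rfl | hj
      · simpa using hxi
      · rw [hx j hj, Function.update_of_ne (hne j hj)]
    · rw [Finset.mem_insert, not_or] at hj
      rw [Function.update_of_ne hj.1, hF j hj.2]

theorem zeroSpace_update {α : ι → Module.Dual ℝ V} {s : Finset ι} {i : ι} (hi : i ∉ s)
    (F : ι → SignType) (a : SignType) :
    zeroSpace α (insert i s) (Function.update F i a) =
      if a = 0 then zeroSpace α s F ⊓ LinearMap.ker (α i) else zeroSpace α s F := by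
  have hne : ∀ j ∈ s, j ≠ i := fun j hj h => hi (h ▸ hj)
  have key : ∀ u, (∀ j ∈ s, Function.update F i a j = 0 → α j u = 0) ↔
      u ∈ zeroSpace α s F := fun u => by
    rw [mem_zeroSpace]
    refine forall₂_congr fun j hj => ?_
    rw [Function.update_of_ne (hne j hj)]
  ext u
  rw [mem_zeroSpace, Finset.forall_mem_insert, key, Function.update_self]
  split_ifs with h
  · simp [h, and_comm]
  · simp [h]

theorem faceSign_update {α : ι → Module.Dual ℝ V} {s : Finset ι} {i : ι} (hi : i ∉ s)
    (F : ι → SignType) (a : SignType) :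
    faceSign α (insert i s) (Function.update F i a) =
      if a = 0 then
        (-1) ^ Module.finrank ℝ (zeroSpace α s F ⊓ LinearMap.ker (α i) : Submodule ℝ V)
      else (-1) ^ Module.finrank ℝ (zeroSpace α s F) := by
  rw [faceSign, zeroSpace_update hi]
  by_cases h : a = 0
  · rw [if_pos h, if_pos h]
  · rw [if_neg h, if_neg h]

/-- The faces of an arrangement with one more hyperplane that lie in a given face `F` of the
smaller one have signed count equal to the sign of `F`. -/
theorem sum_faceSign_update [Fintype ι] [FiniteDimensional ℝ V]
    {α : ι → Module.Dual ℝ V} {s : Finset ι}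
    {i : ι} (hi : i ∉ s) {F : ι → SignType} (hF : F ∈ covectors α s) :
    ∑ a : SignType, (if Function.update F i a ∈ covectors α (insert i s) then
      faceSign α (insert i s) (Function.update F i a) else 0) = faceSign α s F := by
  obtain ⟨x, hx, h0⟩ := mem_covectors.1 hF
  have huniv : (Finset.univ : Finset SignType) = {0, -1, 1} := rfl
  have hm := update_mem_covectors (α := α) hi h0
  simp only [faceSign_update hi]
  rw [faceSign]
  rw [huniv, Finset.sum_insert (by decide), Finset.sum_insert (by decide), Finset.sum_singleton]
  simp only [if_true, if_neg (show (-1 : SignType) ≠ 0 by decide),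
    if_neg (show (1 : SignType) ≠ 0 by decide)]
  by_cases hU : zeroSpace α s F ≤ LinearMap.ker (α i)
  -- The hyperplane contains the whole face: only the subface with sign 0 exists, with the same
  -- span.
  · have hz : ∀ y, (∀ j ∈ s, sign (α j y) = F j) → α i y = 0 := fun y hy =>
      hU (mem_zeroSpace_of_signVec hy)
    rw [if_pos ((hm 0).2 ⟨x, hx, by simp [hz x hx]⟩), if_neg, if_neg, inf_eq_left.2 hU]
    · simp
    · intro hmem
      obtain ⟨y, hy, h⟩ := (hm _).1 hmem
      simp [hz y hy] at h
    · intro hmem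
      obtain ⟨y, hy, h⟩ := (hm _).1 hmem
      simp [hz y hy] at h
  -- Otherwise the face either lies strictly on one side, or is cut into two pieces of its own
  -- dimension and one of dimension one less; the signed count is unchanged since 1 + 1 - 1 = 1.
  · rw [← finrank_inf_ker_add_one _ _ hU, pow_succ]
    obtain ⟨u, hu, hui⟩ := SetLike.not_le_iff_exists.1 hU
    have hui' : α i u ≠ 0 := hui
    rw [mem_zeroSpace] at hu
    -- moving inside the face off the hyperplane
    have hmove : ∀ v, (∀ j ∈ s, F j = 0 → α j v = 0) → ∀ y, (∀ j ∈ s, sign (α j y) = F j) →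
        α i y = 0 → ∃ z, (∀ j ∈ s, sign (α j z) = F j) ∧ sign (α i z) = sign (α i v) := by
      intro v hv y hy hyi
      obtain ⟨z, hz⟩ := exists_sign_comp α (insert i s) y v
      refine ⟨z, fun j hj => ?_, ?_⟩
      · rw [hz j (Finset.mem_insert_of_mem hj), hy j hj]
        split_ifs with h
        · rw [hv j hj h, h, sign_zero]
        · rfl
      · rw [hz i (Finset.mem_insert_self _ _), hyi, sign_zero, if_pos rfl]
    have hu' : ∀ j ∈ s, F j = 0 → α j (-u) = 0 := fun j hj h => by simp [hu j hj h]
    have h0p : (∃ y, (∀ j ∈ s, sign (α j y) = F j) ∧ sign (α i y) = 0) →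
        (∃ y, (∀ j ∈ s, sign (α j y) = F j) ∧ sign (α i y) = -1) ∧
        ∃ y, (∀ j ∈ s, sign (α j y) = F j) ∧ sign (α i y) = 1 := by
      rintro ⟨y, hy, hyi⟩
      have hyi := sign_eq_zero_iff.1 hyi
      obtain ⟨z1, h1, h1'⟩ := hmove u hu y hy hyi
      obtain ⟨z2, h2, h2'⟩ := hmove (-u) hu' y hy hyi
      rcases lt_or_gt_of_ne hui' with h | h
      · exact ⟨⟨z1, h1, by rw [h1', sign_neg h]⟩, z2, h2, by
          rw [h2', map_neg, sign_pos (neg_pos.2 h)]⟩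
      · exact ⟨⟨z2, h2, by rw [h2', map_neg, sign_neg (neg_neg_of_pos h)]⟩, z1, h1, by
          rw [h1', sign_pos h]⟩
    have hp0 : (∃ y, (∀ j ∈ s, sign (α j y) = F j) ∧ sign (α i y) = -1) →
        (∃ y, (∀ j ∈ s, sign (α j y) = F j) ∧ sign (α i y) = 1) →
        ∃ y, (∀ j ∈ s, sign (α j y) = F j) ∧ sign (α i y) = 0 := by
      rintro ⟨y, hy, hyi⟩ ⟨z, hz, hzi⟩
      rw [sign_eq_neg_one_iff] at hyi
      rw [sign_eq_one_iff] at hzi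
      -- Both coefficients are positive, so the signs of `F` persist by convexity, and they are
      -- chosen to cancel `α i`.
      refine ⟨(α i z) • y + (-α i y) • z, fun j hj => ?_, ?_⟩
      · have h1 := hy j hj
        have h2 := hz j hj
        have hyi' : 0 < -α i y := neg_pos.2 hyi
        rw [map_add, map_smul, map_smul, smul_eq_mul, smul_eq_mul]
        rcases hFj : F j with _ | _ | _
        · rw [hFj] at h1 h2
          rw [show SignType.zero = 0 from rfl, sign_eq_zero_iff] at *
          rw [h1, h2]; simp
        · rw [hFj] at h1 h2
          rw [show SignType.neg = -1 from rfl, sign_eq_neg_one_iff] at *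
          nlinarith [mul_neg_of_pos_of_neg hzi h1, mul_neg_of_pos_of_neg hyi' h2]
        · rw [hFj] at h1 h2
          rw [show SignType.pos = 1 from rfl, sign_eq_one_iff] at *
          nlinarith [mul_pos hzi h1, mul_pos hyi' h2]
      · rw [sign_eq_zero_iff]
        simp only [map_add, map_smul, smul_eq_mul]
        ring
    by_cases hp : ∃ y, (∀ j ∈ s, sign (α j y) = F j) ∧ sign (α i y) = 1
    · by_cases hn : ∃ y, (∀ j ∈ s, sign (α j y) = F j) ∧ sign (α i y) = -1
      · rw [if_pos ((hm _).2 hp), if_pos ((hm _).2 hn), if_pos ((hm _).2 (hp0 hn hp))]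
        ring
      · rw [if_pos ((hm _).2 hp), if_neg (mt (hm _).1 hn), if_neg fun h => hn (h0p ((hm _).1 h)).1]
        ring
    · by_cases hn : ∃ y, (∀ j ∈ s, sign (α j y) = F j) ∧ sign (α i y) = -1
      · rw [if_neg (mt (hm _).1 hp), if_pos ((hm _).2 hn), if_neg fun h => hp (h0p ((hm _).1 h)).2]
        ring
      · exfalso
        rcases lt_trichotomy (α i x) 0 with h | h | h
        · exact hn ⟨x, hx, sign_neg h⟩
        · exact hn (h0p ⟨x, hx, by rw [h, sign_zero]⟩).1
        · exact hp ⟨x, hx, sign_pos h⟩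

/-- Signed sums over faces are invariant under refining the arrangement by a hyperplane. -/
theorem sum_covectors_insert [Fintype ι] [FiniteDimensional ℝ V]
    {α : ι → Module.Dual ℝ V} {s : Finset ι}
    {i : ι} (hi : i ∉ s) (g : (ι → SignType) → ℤ)
    (hg : ∀ F a, g (Function.update F i a) = g F) :
    ∑ F ∈ covectors α (insert i s), g F * faceSign α (insert i s) F =
      ∑ F ∈ covectors α s, g F * faceSign α s F := by
  have hmaps : ∀ F ∈ covectors α (insert i s), Function.update F i 0 ∈ covectors α s := by
    intro F hF
    obtain ⟨x, hx, h0⟩ := mem_covectors.1 hF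
    refine mem_covectors.2 ⟨x, fun j hj => ?_, fun j hj => ?_⟩
    · rw [Function.update_of_ne (ne_of_mem_of_not_mem hj hi), hx j (Finset.mem_insert_of_mem hj)]
    · by_cases h : j = i
      · subst h; simp
      · rw [Function.update_of_ne h, h0 j (by simp [h, hj])]
  -- Group the faces of the finer arrangement by the face of the coarser one containing them, found
  -- by resetting coordinate `i` to 0.
  rw [← Finset.sum_fiberwise_of_maps_to hmaps]
  refine Finset.sum_congr rfl fun F hF => ?_
  rw [← sum_faceSign_update hi hF, Finset.mul_sum]
  simp only [mul_ite, mul_zero]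
  rw [← Finset.sum_filter]
  obtain ⟨x, hx, h0⟩ := mem_covectors.1 hF
  refine Finset.sum_nbij' (fun G => G i) (fun a => Function.update F i a) ?_ ?_ ?_ ?_ ?_
  · intro G hG
    obtain ⟨hG1, rfl⟩ := Finset.mem_filter.1 hG
    simpa using hG1
  · intro a ha
    simp only [Finset.mem_filter, Finset.mem_univ, true_and] at ha ⊢
    refine ⟨ha, ?_⟩
    rw [Function.update_idem, ← h0 i hi, Function.update_eq_self]
  · intro G hG
    obtain ⟨-, rfl⟩ := Finset.mem_filter.1 hG
    simp
  · intro a _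
    simp
  · intro G hG
    obtain ⟨-, rfl⟩ := Finset.mem_filter.1 hG
    simp [hg]

end Deletion

end SignVectors
-- Witt's identity.
section Witt

open SignType Filter Topology

variable {V ι : Type*} [AddCommGroup V] [Module ℝ V]

/-- The composition of sign vectors. -/
def signComp (F G : ι → SignType) : ι → SignType := fun j => if F j = 0 then G j else F j

open Classical in
/-- The signed count of the faces `F` with `F ∘ σ = τ` on `s`. -/
noncomputable def wittSum [Fintype ι] (α : ι → Module.Dual ℝ V) (s : Finset ι)
    (σ τ : ι → SignType) : ℤ :=
  ∑ F ∈ covectors α s, (if ∀ j ∈ s, signComp F σ j = τ j then 1 else 0) * faceSign α s F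

-- Since `σ i ≠ 0`, the `i`-th sign of `F ∘ σ` is nonzero, hence equals exactly one of `τ i` and `-τ
-- i`. The two indicators add up to one that ignores coordinate `i`, so the hyperplane `i` can be
-- deleted by `sum_covectors_insert`.
open Classical in
theorem wittSum_add_wittSum_update [Fintype ι] [FiniteDimensional ℝ V]
    {α : ι → Module.Dual ℝ V} {s : Finset ι} {i : ι} (hi : i ∉ s) {σ τ : ι → SignType}
    (hσ : σ i ≠ 0) (hτ : τ i ≠ 0) :
    wittSum α (insert i s) σ τ + wittSum α (insert i s) σ (Function.update τ i (-τ i)) =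
      wittSum α s σ τ := by
  have hne : ∀ j ∈ s, j ≠ i := fun j hj => ne_of_mem_of_not_mem hj hi
  rw [wittSum, wittSum, ← Finset.sum_add_distrib]
  simp only [← add_mul]
  have hg : ∀ F a, (if ∀ j ∈ s, signComp (Function.update F i a) σ j = τ j then (1 : ℤ) else 0) =
      if ∀ j ∈ s, signComp F σ j = τ j then 1 else 0 := by
    intro F a
    refine if_congr (forall₂_congr fun j hj => ?_) rfl rfl
    simp only [signComp, Function.update_of_ne (hne j hj)]
  rw [wittSum, ← sum_covectors_insert hi
    (fun F => if ∀ j ∈ s, signComp F σ j = τ j then (1 : ℤ) else 0) hg]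
  refine Finset.sum_congr rfl fun F _ => ?_
  congr 1
  have h1 : ∀ j ∈ s, Function.update τ i (-τ i) j = τ j := fun j hj =>
    Function.update_of_ne (hne j hj) _ _
  have h2 : (∀ j ∈ s, signComp F σ j = Function.update τ i (-τ i) j) ↔
      ∀ j ∈ s, signComp F σ j = τ j := forall₂_congr fun j hj => by rw [h1 j hj]
  have h3 : signComp F σ i ≠ 0 := by
    rw [signComp]
    split_ifs with h
    · exact hσ
    · exact h
  simp only [Finset.forall_mem_insert, Function.update_self, h2]
  by_cases hall : ∀ j ∈ s, signComp F σ j = τ j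
  · rw [if_congr (and_iff_left hall) rfl rfl, if_congr (and_iff_left hall) rfl rfl, if_pos hall]
    revert h3 hτ
    generalize signComp F σ i = a
    generalize τ i = b
    revert a b
    decide
  · rw [if_neg fun h => hall h.2, if_neg fun h => hall h.2, if_neg hall, add_zero]

open Classical in
/-- Witt's identity. -/
theorem wittSum_eq [Fintype ι] [FiniteDimensional ℝ V] (α : ι → Module.Dual ℝ V) (s : Finset ι)
    (y : V) (σ τ : ι → SignType) (hy : ∀ j ∈ s, sign (α j y) = σ j) (hσ : ∀ j ∈ s, σ j ≠ 0)
    (hτ : ∀ j ∈ s, τ j ≠ 0) :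
    wittSum α s σ τ = if ∀ j ∈ s, τ j = -σ j then (-1) ^ Module.finrank ℝ V else 0 := by
  -- Outer induction on the set of hyperplanes, inner induction on the number of places where `τ`
  -- differs from `-σ`.
  induction s using Finset.strongInduction generalizing τ with
  | H s ih =>
  induction hk : (s.filter fun j => τ j ≠ -σ j).card generalizing τ with
  | zero =>
    have hall : ∀ j ∈ s, τ j = -σ j := by
      intro j hj
      by_contra h
      exact Finset.notMem_empty j (Finset.card_eq_zero.1 hk ▸ Finset.mem_filter.2 ⟨hj, h⟩)
    -- A zero of `F` would leave the sign `σ j` instead of `-σ j`, so only the open chamber of `-y`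
    -- contributes.
    rw [if_pos hall, wittSum, Finset.sum_eq_single (signVec α s (-y))]
    · have hv := signVec_eq_iff.1 (rfl : signVec α s (-y) = signVec α s (-y))
      have hne : ∀ j ∈ s, signVec α s (-y) j = -σ j := by
        intro j hj
        rw [← hv.1 j hj, map_neg, Left.sign_neg, hy j hj]
      have hz : zeroSpace α s (signVec α s (-y)) = ⊤ := by
        rw [eq_top_iff]
        intro u _
        refine mem_zeroSpace.2 fun j hj h => ?_
        rw [hne j hj] at h
        exact absurd h ((by decide : ∀ a : SignType, a ≠ 0 → -a ≠ 0) _ (hσ j hj))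
      rw [if_pos, one_mul, faceSign, hz, finrank_top]
      intro j hj
      rw [signComp, hne j hj, if_neg ((by decide : ∀ a : SignType, a ≠ 0 → -a ≠ 0) _ (hσ j hj)),
        hall j hj]
    · intro F hF hne
      rw [if_neg, zero_mul]
      intro h
      obtain ⟨x, hx, h0⟩ := mem_covectors.1 hF
      refine hne (signVec_eq_iff.2 ⟨fun j hj => ?_, h0⟩).symm
      have h1 := h j hj
      rw [hall j hj, signComp] at h1
      rw [map_neg, Left.sign_neg, hy j hj]
      split_ifs at h1 with h2
      · exact absurd h1 ((by decide : ∀ a : SignType, a ≠ 0 → a ≠ -a) _ (hσ j hj))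
      · exact h1.symm
    · intro h
      exact absurd (mem_covectors.2 ⟨-y, signVec_eq_iff.1 rfl⟩) h
  | succ k ihk =>
    obtain ⟨i, hi⟩ := Finset.card_pos.1 (by rw [hk]; exact k.succ_pos)
    obtain ⟨his, hi⟩ := Finset.mem_filter.1 hi
    have hσi := hσ i his
    have hτi := hτ i his
    have hflip : -τ i = -σ i := by
      revert hσi hτi hi
      generalize σ i = a
      generalize τ i = b
      revert a b
      decide
    have hadd := wittSum_add_wittSum_update (α := α) (Finset.notMem_erase i s) hσi hτi
    rw [Finset.insert_erase his] at hadd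
    have hu : ∀ j ∈ s.erase i, Function.update τ i (-τ i) j = τ j := fun j hj =>
      Function.update_of_ne (Finset.ne_of_mem_erase hj) _ _
    rw [ih _ (Finset.erase_ssubset his) _ (fun j hj => hy j (Finset.mem_of_mem_erase hj))
      (fun j hj => hσ j (Finset.mem_of_mem_erase hj))
      (fun j hj => hτ j (Finset.mem_of_mem_erase hj)), 
      ihk (Function.update τ i (-τ i))] at hadd
    · rw [if_neg fun h => hi (h i his)]
      have hiff : (∀ j ∈ s, Function.update τ i (-τ i) j = -σ j) ↔
          ∀ j ∈ s.erase i, τ j = -σ j := by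
        rw [← Finset.insert_erase his, Finset.forall_mem_insert, Function.update_self,
          and_iff_right hflip, Finset.erase_insert (Finset.notMem_erase i s)]
        exact forall₂_congr fun j hj => by rw [hu j hj]
      -- The sum for the flipped `τ` and the sum over `s.erase i` have the same value, so the
      -- remaining term is 0.
      rw [if_congr hiff rfl rfl] at hadd
      linarith
    · intro j hj
      by_cases hji : j = i
      · subst hji
        rw [Function.update_self]
        exact (by decide : ∀ a : SignType, a ≠ 0 → -a ≠ 0) _ hτi
      · rw [Function.update_of_ne hji]
        exact hτ j hj
    · have hE : (s.filter fun j => Function.update τ i (-τ i) j ≠ -σ j) =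
          (s.filter fun j => τ j ≠ -σ j).erase i := by
        ext j
        by_cases hji : j = i
        · subst hji
          simp [hflip]
        · simp [hji]
      rw [hE, Finset.card_erase_of_mem (Finset.mem_filter.2 ⟨his, hi⟩), hk]
      rfl

end Witt
-- Nonsingularity of the distance matrix away from roots of unity.
section Nonsingular

open SignType

variable {V ι : Type*} [AddCommGroup V] [Module ℝ V]

open Classical in
/-- The topes of the arrangement indexed by `s`: the covectors without zeros. -/
noncomputable def topes [Fintype ι] (α : ι → Module.Dual ℝ V) (s : Finset ι) :
    Finset (ι → SignType) :=
  {F ∈ covectors α s | ∀ j ∈ s, F j ≠ 0}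

open Classical in
/-- The number of forms in `s` on which two sign vectors differ. -/
noncomputable def signDist (s : Finset ι) (F G : ι → SignType) : ℕ :=
  {j ∈ s | F j ≠ G j}.card

theorem signDist_congr {s : Finset ι} {F F' G G' : ι → SignType} (hF : ∀ j ∈ s, F j = F' j)
    (hG : ∀ j ∈ s, G j = G' j) : signDist s F G = signDist s F' G' := by
  classical
  unfold signDist
  congr 1
  exact Finset.filter_congr fun j hj => by rw [hF j hj, hG j hj]

theorem signDist_eq_zero {s : Finset ι} {F G : ι → SignType} (h : ∀ j ∈ s, F j = G j) :
    signDist s F G = 0 := by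
  classical
  rw [signDist, Finset.card_eq_zero, Finset.filter_eq_empty_iff]
  exact fun j hj h' => h' (h j hj)

theorem signDist_eq_card {s : Finset ι} {F G : ι → SignType} (h : ∀ j ∈ s, F j ≠ G j) :
    signDist s F G = s.card := by
  classical
  rw [signDist, Finset.filter_true_of_mem h]

theorem signDist_filter_add (s : Finset ι) (p : ι → Prop) [DecidablePred p]
    (F G : ι → SignType) :
    signDist (s.filter p) F G + signDist (s.filter fun j => ¬ p j) F G = signDist s F G := by
  classical
  unfold signDist
  rw [← Finset.card_filter_add_card_filter_not (s := s.filter fun j => F j ≠ G j) p]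
  simp only [Finset.filter_filter, and_comm]

theorem mem_topes [Fintype ι] {α : ι → Module.Dual ℝ V} {s : Finset ι} {F : ι → SignType} :
    F ∈ topes α s ↔ (∃ x, ∀ j ∈ s, sign (α j x) = F j) ∧ (∀ j ∉ s, F j = 0) ∧
      ∀ j ∈ s, F j ≠ 0 := by
  simp only [topes, Finset.mem_filter, mem_covectors]
  constructor
  · rintro ⟨⟨x, h1, h2⟩, h3⟩
    exact ⟨⟨x, h1⟩, h2, h3⟩
  · rintro ⟨⟨x, h1⟩, h2, h3⟩
    exact ⟨⟨x, h1, h2⟩, h3⟩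

theorem neg_mem_topes [Fintype ι] {α : ι → Module.Dual ℝ V} {s : Finset ι} {F : ι → SignType}
    (hF : F ∈ topes α s) : -F ∈ topes α s := by
  obtain ⟨⟨x, h1⟩, h2, h3⟩ := mem_topes.1 hF
  refine mem_topes.2 ⟨⟨-x, fun j hj => ?_⟩, fun j hj => ?_, fun j hj => ?_⟩
  · rw [map_neg, Left.sign_neg, h1 j hj, Pi.neg_apply]
  · rw [Pi.neg_apply, h2 j hj]; rfl
  · exact (by decide : ∀ a : SignType, a ≠ 0 → -a ≠ 0) _ (h3 j hj)

theorem eq_of_mem_topes [Fintype ι] {α : ι → Module.Dual ℝ V} {s : Finset ι}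
    {F G : ι → SignType} (hF : F ∈ topes α s) (hG : G ∈ topes α s) (h : ∀ j ∈ s, F j = G j) :
    F = G := by
  funext j
  by_cases hj : j ∈ s
  · exact h j hj
  · rw [(mem_topes.1 hF).2.1 j hj, (mem_topes.1 hG).2.1 j hj]

open Classical in
/-- A vector in the kernel of the distance matrix restricts to vectors in the kernels of the
distance matrices of the localizations; if these are nonsingular, then the partial sums over the
topes projecting to `C` vanish. -/
theorem sum_signComp_eq_zero [Fintype ι] {𝕜 : Type*} [Field 𝕜] {q : 𝕜}
    {α : ι → Module.Dual ℝ V} {s : Finset ι}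
    (ih : ∀ t ⊂ s, ∀ w : (ι → SignType) → 𝕜,
      (∀ C ∈ topes α t, ∑ D ∈ topes α t, q ^ signDist t C D * w D = 0) →
        ∀ C ∈ topes α t, w C = 0)
    {w : (ι → SignType) → 𝕜}
    (hw : ∀ C ∈ topes α s, ∑ D ∈ topes α s, q ^ signDist s C D * w D = 0)
    {F C : ι → SignType} (hF : F ∈ covectors α s) (hF0 : F ≠ 0) (hC : C ∈ topes α s) :
    ∑ D ∈ topes α s with ∀ j ∈ s, signComp F D j = C j, q ^ signDist s C D * w D = 0 := by
  obtain ⟨x, hx, hx0⟩ := mem_covectors.1 hF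
  obtain ⟨⟨c, hc⟩, hC0, hC1⟩ := mem_topes.1 hC
  -- Compositions `F ∘ D` agree with `F` on its support, so the sum is empty unless `C` does too.
  by_cases hFC : ∀ j ∈ s, F j ≠ 0 → C j = F j
  swap
  · rw [Finset.filter_false_of_mem, Finset.sum_empty]
    intro D _ h
    refine hFC fun j hj h0 => ?_
    rw [← h j hj, signComp, if_neg h0]
  have hts : s.filter (fun j => F j = 0) ⊂ s := by
    refine Finset.filter_ssubset.2 ?_
    by_contra! hall
    refine hF0 (funext fun j => ?_)
    by_cases hj : j ∈ s
    · exact hall j hj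
    · exact hx0 j hj
  set t := s.filter fun j => F j = 0 with ht
  set t' := s.filter fun j => ¬ F j = 0 with ht'
  have hmt : ∀ j, j ∈ t ↔ j ∈ s ∧ F j = 0 := fun j => Finset.mem_filter
  have hmt' : ∀ j, j ∈ t' ↔ j ∈ s ∧ ¬ F j = 0 := fun j => Finset.mem_filter
  let r : (ι → SignType) → ι → SignType := fun G j => if j ∈ t then G j else 0
  have hrt : ∀ G, ∀ j ∈ t, r G j = G j := fun G j hj => if_pos hj
  have hr : ∀ G ∈ topes α s, r G ∈ topes α t := by
    intro G hG
    obtain ⟨⟨y, h1⟩, h2, h3⟩ := mem_topes.1 hG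
    refine mem_topes.2 ⟨⟨y, fun j hj => ?_⟩, fun j hj => if_neg hj, fun j hj => ?_⟩
    · rw [hrt G j hj, h1 j ((hmt j).1 hj).1]
    · rw [hrt G j hj]
      exact h3 j ((hmt j).1 hj).1
  -- The induction hypothesis is applied to the push-forward of `w` along restriction to `t`,
  -- weighted by the distance from `F` on the complementary forms `t'`.
  have hzero := ih t hts
    (fun E => ∑ D ∈ topes α s with r D = E, q ^ signDist t' F D * w D) ?_ (r C) (hr C hC)
  · rw [← hzero]
    refine Finset.sum_congr (Finset.filter_congr fun D hD => ?_) fun D hD => ?_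
    · constructor
      · intro h
        funext j
        by_cases hj : j ∈ t
        · rw [hrt _ j hj, hrt _ j hj, ← h j ((hmt j).1 hj).1, signComp, if_pos ((hmt j).1 hj).2]
        · simp only [r, if_neg hj]
      · intro h j hj
        rw [signComp]
        split_ifs with h0
        · have hj' := (hmt j).2 ⟨hj, h0⟩
          rw [← hrt D j hj', h, hrt C j hj']
        · exact (hFC j hj h0).symm
    -- On this fibre `C` and `D` agree on `t`, and `C = F` on `t'`, so only the distance on `t'`
    -- remains.
    · have h := (Finset.mem_filter.1 hD).2
      rw [← signDist_filter_add s (fun j => F j = 0), ← ht, ← ht', signDist_eq_zero, zero_add,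
        signDist_congr (F' := F) (fun j hj => ?_) fun j _ => rfl]
      · exact hFC j ((hmt' j).1 hj).1 ((hmt' j).1 hj).2
      · intro j hj
        rw [← hrt D j hj, h, hrt C j hj]
  · intro E hE
    obtain ⟨⟨y, hy⟩, hE0, hE1⟩ := mem_topes.1 hE
    -- The kernel equation for the localization at `E` is the original one at the tope `F ∘ E`,
    -- whose distances split into a `t`-part seen by `E` and a `t'`-part seen by `F`.
    obtain ⟨z, hz⟩ := exists_sign_comp α s x y
    have hzt : ∀ j ∈ t, sign (α j z) = E j := fun j hj => by
      rw [hz j ((hmt j).1 hj).1, hx j ((hmt j).1 hj).1, if_pos ((hmt j).1 hj).2, hy j hj]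
    have hzt' : ∀ j ∈ t', sign (α j z) = F j := fun j hj => by
      rw [hz j ((hmt' j).1 hj).1, hx j ((hmt' j).1 hj).1, if_neg ((hmt' j).1 hj).2]
    have hv := signVec_eq_iff.1 (rfl : signVec α s z = signVec α s z)
    have hG : signVec α s z ∈ topes α s := by
      refine mem_topes.2 ⟨⟨z, hv.1⟩, hv.2, fun j hj => ?_⟩
      rw [← hv.1 j hj]
      by_cases h0 : F j = 0
      · rw [hzt j ((hmt j).2 ⟨hj, h0⟩)]
        exact hE1 j ((hmt j).2 ⟨hj, h0⟩)
      · rwa [hzt' j ((hmt' j).2 ⟨hj, h0⟩)]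
    rw [← hw _ hG, ← Finset.sum_fiberwise_of_maps_to hr]
    refine Finset.sum_congr rfl fun E' _ => ?_
    rw [Finset.mul_sum]
    refine Finset.sum_congr rfl fun D hD => ?_
    obtain ⟨hD, rfl⟩ := Finset.mem_filter.1 hD
    rw [← signDist_filter_add s (fun j => F j = 0), ← ht, ← ht', pow_add, mul_assoc,
      signDist_congr (s := t) (fun j hj => ?_) (hrt D),
      signDist_congr (s := t') (fun j hj => ?_) fun j _ => rfl]
    · rw [← hv.1 j ((hmt' j).1 hj).1, hzt' j hj]
    · rw [← hv.1 j ((hmt j).1 hj).1, hzt j hj]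

open Classical in
/-- The distance matrix of the topes is nonsingular if `q` is not a root of unity. -/
theorem eq_zero_of_sum_signDist_eq_zero [Fintype ι] [FiniteDimensional ℝ V] {𝕜 : Type*}
    [Field 𝕜] {q : 𝕜} (hq : ∀ k, 0 < k → q ^ k ≠ 1) (α : ι → Module.Dual ℝ V) (s : Finset ι)
    (w : (ι → SignType) → 𝕜)
    (hw : ∀ C ∈ topes α s, ∑ D ∈ topes α s, q ^ signDist s C D * w D = 0) :
    ∀ C ∈ topes α s, w C = 0 := by
  induction s using Finset.strongInduction generalizing w with
  | H s ih =>
  rcases s.eq_empty_or_nonempty with rfl | hs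
  · intro C hC
    have h := hw C hC
    rw [Finset.sum_eq_single C] at h
    · simpa [signDist] using h
    · intro D hD hne
      exact absurd (eq_of_mem_topes hD hC (by simp)) hne
    · exact fun h => absurd hC h
  have h0 : (0 : ι → SignType) ∈ covectors α s := mem_covectors.2 ⟨0, by simp, by simp⟩
  have key : ∀ C ∈ topes α s, (faceSign α s 0 : 𝕜) * w C =
      (-1) ^ Module.finrank ℝ V * (q ^ s.card * w (-C)) := by
    intro C hC
    obtain ⟨⟨c, hc⟩, hC0, hC1⟩ := mem_topes.1 hC
    -- Double count. Summed over `D` first, every face `F ≠ 0` contributes 0 and `F = 0` leaves only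
    -- `D = C`; below, Witt's identity leaves only `D = -C`.
    have h1 : ∑ D ∈ topes α s, (wittSum α s D C : 𝕜) * (q ^ signDist s C D * w D) =
        (faceSign α s 0 : 𝕜) * w C := by
      simp only [wittSum, Int.cast_sum, Int.cast_mul, Int.cast_ite, Int.cast_one, Int.cast_zero,
        Finset.sum_mul]
      rw [Finset.sum_comm, Finset.sum_eq_single 0]
      · rw [Finset.sum_eq_single C]
        · rw [if_pos, signDist_eq_zero fun _ _ => rfl]
          · simp
          · intro j _
            simp [signComp]
        · intro D hD hne
          rw [if_neg, zero_mul, zero_mul]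
          intro h
          exact hne (eq_of_mem_topes hD hC fun j hj => by simpa [signComp] using h j hj)
        · exact fun h => absurd hC h
      · intro F hF hF0
        have h2 := sum_signComp_eq_zero ih hw hF hF0 hC
        rw [Finset.sum_filter] at h2
        have h3 := congrArg (fun a => (faceSign α s F : 𝕜) * a) h2
        simp only [Finset.mul_sum, mul_zero] at h3
        refine (Finset.sum_congr rfl fun D _ => ?_).trans h3
        split_ifs <;> ring
      · exact fun h => absurd h0 h
    rw [← h1, Finset.sum_eq_single (-C)]
    · have hnC := neg_mem_topes hC
      obtain ⟨⟨y, hy⟩, -, hy1⟩ := mem_topes.1 hnC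
      rw [wittSum_eq α s y _ _ hy hy1 hC1, if_pos, signDist_eq_card]
      · push_cast; ring
      · intro j hj
        exact (by decide : ∀ a : SignType, a ≠ 0 → a ≠ -a) _ (hC1 j hj)
      · intro j _
        simp
    · intro D hD hne
      obtain ⟨⟨y, hy⟩, -, hy1⟩ := mem_topes.1 hD
      rw [wittSum_eq α s y _ _ hy hy1 hC1, if_neg, Int.cast_zero, zero_mul]
      intro h
      refine hne (eq_of_mem_topes hD (neg_mem_topes hC) fun j hj => ?_)
      rw [Pi.neg_apply, h j hj, neg_neg]
    · exact fun h => absurd (neg_mem_topes hC) h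
  intro C hC
  have h1 := key C hC
  have h2 := key (-C) (neg_mem_topes hC)
  rw [neg_neg] at h2
  have hε : (faceSign α s 0 : 𝕜) * faceSign α s 0 = 1 := by
    rw [faceSign]
    push_cast
    rw [← pow_add, Even.neg_one_pow ⟨_, rfl⟩]
  have hδ : ((-1 : 𝕜) ^ Module.finrank ℝ V) * (-1) ^ Module.finrank ℝ V = 1 := by
    rw [← pow_add, Even.neg_one_pow ⟨_, rfl⟩]
  have h3 : (q ^ (s.card + s.card) - 1) * w C = 0 := by
    rw [pow_add]
    generalize (faceSign α s 0 : 𝕜) = e at *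
    generalize ((-1 : 𝕜) ^ Module.finrank ℝ V) = f at *
    generalize q ^ s.card = a at *
    linear_combination (-e) * h1 + (-f * a) * h2 + w C * hε - a * a * w C * hδ
  rcases mul_eq_zero.1 h3 with h | h
  · exact absurd (sub_eq_zero.1 h) (hq _ (by have := hs.card_pos; omega))
  · exact h

end Nonsingular
-- Geodesics between topes.
section Gallery

open SignType Filter Topology

variable {V ι : Type*} [AddCommGroup V] [Module ℝ V]

theorem signDist_triangle (s : Finset ι) (F G K : ι → SignType) :
    signDist s F K ≤ signDist s F G + signDist s G K := by
  classical
  unfold signDist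
  refine (Finset.card_le_card fun j hj => ?_).trans (Finset.card_union_le _ _)
  simp only [Finset.mem_union, Finset.mem_filter] at hj ⊢
  by_cases h : F j = G j
  · exact Or.inr ⟨hj.1, h ▸ hj.2⟩
  · exact Or.inl ⟨hj.1, h⟩

theorem signDist_add_of_between {s : Finset ι} {F G K : ι → SignType}
    (h : ∀ j ∈ s, G j = F j ∨ G j = K j) :
    signDist s F G + signDist s G K = signDist s F K := by
  classical
  unfold signDist
  rw [← Finset.card_union_of_disjoint]
  · congr 1
    ext j
    simp only [Finset.mem_union, Finset.mem_filter]
    constructor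
    · rintro (⟨hj, h1⟩ | ⟨hj, h1⟩) <;> rcases h j hj with h2 | h2
      · exact absurd h2.symm h1
      · exact ⟨hj, h2 ▸ h1⟩
      · exact ⟨hj, h2 ▸ h1⟩
      · exact absurd h2 h1
    · rintro ⟨hj, h1⟩
      rcases h j hj with h2 | h2
      · exact Or.inr ⟨hj, h2 ▸ h1⟩
      · exact Or.inl ⟨hj, h2 ▸ h1⟩
  · rw [Finset.disjoint_left]
    intro j h1 h2
    obtain ⟨hj, h1⟩ := Finset.mem_filter.1 h1
    obtain ⟨-, h2⟩ := Finset.mem_filter.1 h2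
    rcases h j hj with h3 | h3
    · exact h1 h3.symm
    · exact h2 h3

theorem sign_pos_combination {a b u v : ℝ} (ha : 0 < a) (hb : 0 < b)
    (h : sign (a * u + b * v) ≠ 0) :
    sign (a * u + b * v) = sign u ∨ sign (a * u + b * v) = sign v := by
  rcases lt_trichotomy (a * u + b * v) 0 with h1 | h1 | h1
  · rcases lt_or_ge u 0 with h2 | h2
    · left; rw [sign_neg h1, sign_neg h2]
    · right
      rw [sign_neg h1, sign_neg]
      by_contra! h3
      nlinarith [mul_nonneg ha.le h2, mul_nonneg hb.le h3]
  · rw [h1, sign_zero] at h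
    exact absurd rfl h
  · rcases lt_or_ge 0 u with h2 | h2
    · left; rw [sign_pos h1, sign_pos h2]
    · right
      rw [sign_pos h1, sign_pos]
      by_contra! h3
      nlinarith [mul_nonneg ha.le (neg_nonneg.2 h2), mul_nonneg hb.le (neg_nonneg.2 h3)]

/-- Given forms `α i`, `α j` with different kernels, the first of which separates `x` from `y`,
there is a point between `x` and `y` at which their signs are taken from different ends. -/
theorem exists_sign_between [Finite ι] (α : ι → Module.Dual ℝ V) {x y : V}
    (hx : ∀ k, sign (α k x) ≠ 0) (hy : ∀ k, sign (α k y) ≠ 0) {i j : ι}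
    (hker : LinearMap.ker (α i) ≠ LinearMap.ker (α j))
    (hi : sign (α i x) ≠ sign (α i y)) :
    ∃ z, (∀ k, sign (α k z) ≠ 0) ∧
      (∀ k, sign (α k z) = sign (α k x) ∨ sign (α k z) = sign (α k y)) ∧
      ((sign (α i z) = sign (α i x) ∧ sign (α j z) = sign (α j y)) ∨
        (sign (α i z) = sign (α i y) ∧ sign (α j z) = sign (α j x))) := by
  have := Fintype.ofFinite ι
  have hiy : α i y ≠ 0 := fun h => hy i (by rw [h, sign_zero])
  have hjy : α j y ≠ 0 := fun h => hy j (by rw [h, sign_zero])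
  -- Up to sign, `β x'` is the value of `α j` at the point where the segment from `x'` to `y` meets
  -- the kernel of `α i` (suitably scaled). The kernels differ, so `β ≠ 0`, and a small move of `x`
  -- makes this value nonzero.
  let β : Module.Dual ℝ V := α j y • α i - α i y • α j
  have hβ : ∃ v, β v ≠ 0 := by
    by_contra! h
    refine hker ?_
    ext v
    have h1 : α j y * α i v - α i y * α j v = 0 := by simpa [β] using h v
    simp only [LinearMap.mem_ker]
    constructor
    · intro h2
      rw [h2, mul_zero, zero_sub, neg_eq_zero] at h1
      exact (mul_eq_zero.1 h1).resolve_left hiy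
    · intro h2
      rw [h2, mul_zero, sub_zero] at h1
      exact (mul_eq_zero.1 h1).resolve_left hjy
  obtain ⟨v, hv⟩ := hβ
  obtain ⟨x', hx', hβx'⟩ : ∃ x', (∀ k, sign (α k x') = sign (α k x)) ∧ β x' ≠ 0 := by
    have h1 : ∀ᶠ ε in 𝓝[>] (0 : ℝ), ∀ k, sign (α k (x + ε • v)) = sign (α k x) :=
      eventually_all.2 fun k => (eventually_sign_add_smul (α k) x v).mono fun ε h => by
        rw [h, if_neg (hx k)]
    obtain ⟨ε, h1, h2⟩ := (h1.and (eventually_sign_add_smul β x v)).exists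
    refine ⟨x + ε • v, h1, fun h3 => ?_⟩
    rw [h3, sign_zero] at h2
    split_ifs at h2 with h4
    · exact hv (sign_eq_zero_iff.1 h2.symm)
    · exact h4 h2.symm
  have hix' : α i x' ≠ 0 := fun h => hx i (by rw [← hx' i, h, sign_zero])
  let p := |α i y| • x' + |α i x'| • y
  have hp : ∀ k, α k p = |α i y| * α k x' + |α i x'| * α k y := fun k => by simp [p]
  have hpk : ∀ k, sign (α k p) ≠ 0 →
      sign (α k p) = sign (α k x) ∨ sign (α k p) = sign (α k y) := by
    intro k hk
    rw [hp] at hk ⊢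
    rw [← hx' k]
    exact sign_pos_combination (abs_pos.2 hiy) (abs_pos.2 hix') hk
  rw [← hx' i] at hi
  have hβx'' : α j y * α i x' - α i y * α j x' ≠ 0 := by simpa [β] using hβx'
  have hpij : α i p = 0 ∧ α j p ≠ 0 := by
    rw [hp, hp]
    rcases lt_or_gt_of_ne hiy with h1 | h1 <;> rcases lt_or_gt_of_ne hix' with h2 | h2
    · rw [sign_neg h1, sign_neg h2] at hi
      exact absurd rfl hi
    · rw [abs_of_neg h1, abs_of_pos h2]
      exact ⟨by ring, fun h => hβx'' (by linear_combination h)⟩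
    · rw [abs_of_pos h1, abs_of_neg h2]
      exact ⟨by ring, fun h => hβx'' (by linear_combination -h)⟩
    · rw [sign_pos h1, sign_pos h2] at hi
      exact absurd rfl hi
  have hpi : sign (α i p) = 0 := by rw [hpij.1, sign_zero]
  have hpj : sign (α j p) ≠ 0 := fun h => hpij.2 (sign_eq_zero_iff.1 h)
  -- `α j` already has the sign of one end at `p`; nudging `p` towards the other end gives `α i` the
  -- sign of that other end.
  rcases hpk j hpj with h | h
  · obtain ⟨z, hz⟩ := exists_sign_comp α Finset.univ p y
    simp only [Finset.mem_univ, true_imp_iff] at hz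
    refine ⟨z, fun k => ?_, fun k => ?_, Or.inr ⟨?_, ?_⟩⟩
    · rw [hz k]
      split_ifs with h1
      exacts [hy k, h1]
    · rw [hz k]
      split_ifs with h1
      exacts [Or.inr rfl, hpk k h1]
    · rw [hz i, if_pos hpi]
    · rw [hz j, if_neg hpj, h]
  · obtain ⟨z, hz⟩ := exists_sign_comp α Finset.univ p x
    simp only [Finset.mem_univ, true_imp_iff] at hz
    refine ⟨z, fun k => ?_, fun k => ?_, Or.inl ⟨?_, ?_⟩⟩
    · rw [hz k]
      split_ifs with h1
      exacts [hx k, h1]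
    · rw [hz k]
      split_ifs with h1
      exacts [Or.inl rfl, hpk k h1]
    · rw [hz i, if_pos hpi]
    · rw [hz j, if_neg hpj, h]

/-- Between two distinct topes there is a tope adjacent to the first one. -/
theorem exists_adjacent_tope [Fintype ι] {α : ι → Module.Dual ℝ V}
    (hker : Function.Injective fun i => LinearMap.ker (α i)) {C D : ι → SignType}
    (hC : C ∈ topes α Finset.univ) (hD : D ∈ topes α Finset.univ) (hCD : C ≠ D) :
    ∃ T ∈ topes α Finset.univ, signDist Finset.univ C T = 1 ∧
      signDist Finset.univ T D + 1 = signDist Finset.univ C D := by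
  classical
  -- Take the tope nearest to `C` among those between `C` and `D`. If two forms separated it from
  -- `C`, `exists_sign_between` would produce a strictly nearer one.
  obtain ⟨T, hT, hmin⟩ := Finset.exists_min_image
    ((topes α Finset.univ).filter fun T => T ≠ C ∧ ∀ j, T j = C j ∨ T j = D j)
    (fun T => signDist Finset.univ C T)
    ⟨D, Finset.mem_filter.2 ⟨hD, hCD.symm, fun j => Or.inr rfl⟩⟩
  obtain ⟨hT, hTC, hTb⟩ := Finset.mem_filter.1 hT
  have hone : signDist Finset.univ C T = 1 := by
    refine le_antisymm ?_ ?_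
    · by_contra! h
      obtain ⟨i, hi, j, hj, hij⟩ := Finset.one_lt_card.1 h
      replace hi := (Finset.mem_filter.1 hi).2
      replace hj := (Finset.mem_filter.1 hj).2
      obtain ⟨⟨x, hx⟩, -, hC1⟩ := mem_topes.1 hC
      obtain ⟨⟨y, hy⟩, -, hT1⟩ := mem_topes.1 hT
      simp only [Finset.mem_univ, true_imp_iff] at hx hy hC1 hT1
      obtain ⟨z, hz0, hzb, hzij⟩ := exists_sign_between α (x := x) (y := y)
        (fun k => by rw [hx]; exact hC1 k) (fun k => by rw [hy]; exact hT1 k)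
        (hker.ne hij) (by rwa [hx, hy])
      simp only [hx, hy] at hzb hzij
      let Z : ι → SignType := fun k => sign (α k z)
      have hZ : Z ∈ topes α Finset.univ :=
        mem_topes.2 ⟨⟨z, fun _ _ => rfl⟩, by simp, fun k _ => hz0 k⟩
      have hZC : Z ≠ C := by
        intro h
        rcases hzij with h1 | h1
        · exact hj ((congrFun h j).symm.trans h1.2)
        · exact hi ((congrFun h i).symm.trans h1.1)
      have hZT : Z ≠ T := by
        intro h
        rcases hzij with h1 | h1
        · exact hi (h1.1.symm.trans (congrFun h i))
        · exact hj (h1.2.symm.trans (congrFun h j))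
      have h1 := hmin Z (Finset.mem_filter.2 ⟨hZ, hZC, fun k => ?_⟩)
      · have h2 := signDist_add_of_between (s := Finset.univ) fun k _ => hzb k
        have h3 : signDist Finset.univ Z T = 0 := by
          change signDist Finset.univ C Z + signDist Finset.univ Z T = _ at h2
          omega
        rw [signDist, Finset.card_eq_zero, Finset.filter_eq_empty_iff] at h3
        exact hZT (funext fun k => not_not.1 (h3 (Finset.mem_univ k)))
      · rcases hzb k with h1 | h1
        · exact Or.inl h1
        · rcases hTb k with h2 | h2
          · exact Or.inl (h1.trans h2)
          · exact Or.inr (h1.trans h2)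
    · rw [Nat.one_le_iff_ne_zero]
      intro h
      rw [signDist, Finset.card_eq_zero, Finset.filter_eq_empty_iff] at h
      exact hTC (funext fun k => (not_not.1 (h (Finset.mem_univ k))).symm)
  refine ⟨T, hT, hone, ?_⟩
  rw [← signDist_add_of_between (s := Finset.univ) fun k _ => hTb k, hone, add_comm]

end Gallery
-- Chambers as topes, and the tope graph distance.
namespace CentralArrangement

open SignType

variable {d : ℕ} (A : CentralArrangement d)

/-- A linear form defining the hyperplane `H`. -/
noncomputable def form (H : A.hyperplanes) : Module.Dual ℝ (EuclideanSpace ℝ (Fin d)) :=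
  (A.exists_ker_eq H).choose

theorem ker_form (H : A.hyperplanes) : LinearMap.ker (A.form H) = H.1 :=
  (A.exists_ker_eq H).choose_spec

theorem ker_form_injective : Function.Injective fun H => LinearMap.ker (A.form H) := by
  intro H K h
  apply Subtype.ext
  rw [← A.ker_form H, ← A.ker_form K]
  exact h

theorem mem_complement_iff {x : EuclideanSpace ℝ (Fin d)} :
    x ∈ A.complement ↔ ∀ H, sign (A.form H x) ≠ 0 := by
  constructor
  · intro h H h0
    refine h H.1 H.2 ?_
    rw [← A.ker_form H]
    exact sign_eq_zero_iff.1 h0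
  · intro h H hH hx
    refine h ⟨H, hH⟩ (sign_eq_zero_iff.2 ?_)
    have hker : LinearMap.ker (A.form ⟨H, hH⟩) = H := A.ker_form ⟨H, hH⟩
    rwa [← hker] at hx

/-- A point of a chamber. -/
noncomputable def point (C : A.chambers) : EuclideanSpace ℝ (Fin d) := C.2.choose

theorem point_mem_complement (C : A.chambers) : A.point C ∈ A.complement := C.2.choose_spec.1

theorem coe_chamber (C : A.chambers) : C.1 = connectedComponentIn A.complement (A.point C) :=
  C.2.choose_spec.2

theorem point_mem (C : A.chambers) : A.point C ∈ C.1 := by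
  rw [A.coe_chamber C]
  exact mem_connectedComponentIn (A.point_mem_complement C)

/-- The sign vector of a chamber. -/
noncomputable def chamberSign (C : A.chambers) (H : A.hyperplanes) : SignType :=
  sign (A.form H (A.point C))

theorem chamberSign_ne_zero (C : A.chambers) (H : A.hyperplanes) : A.chamberSign C H ≠ 0 :=
  A.mem_complement_iff.1 (A.point_mem_complement C) H

/-- A chamber is connected and avoids the hyperplanes, so the intermediate value theorem forbids a
change of sign. -/
theorem sign_form_of_mem {C : A.chambers} {x : EuclideanSpace ℝ (Fin d)} (hx : x ∈ C.1)
    (H : A.hyperplanes) : sign (A.form H x) = A.chamberSign C H := by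
  have hpre : IsPreconnected C.1 := by
    rw [A.coe_chamber C]
    exact isPreconnected_connectedComponentIn
  have hsub : C.1 ⊆ A.complement := by
    rw [A.coe_chamber C]
    exact connectedComponentIn_subset _ _
  have hcont : ContinuousOn (A.form H) C.1 :=
    (LinearMap.continuous_of_finiteDimensional (A.form H)).continuousOn
  have hne : ∀ y ∈ C.1, A.form H y ≠ 0 := fun y hy h =>
    A.mem_complement_iff.1 (hsub hy) H (sign_eq_zero_iff.2 h)
  have hno : ∀ y ∈ C.1, ∀ z ∈ C.1, A.form H y < 0 → 0 < A.form H z → False := by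
    intro y hy z hz h1 h2
    obtain ⟨t, ht, ht0⟩ := hpre.intermediate_value hy hz hcont ⟨h1.le, h2.le⟩
    exact hne t ht ht0
  have hp := A.point_mem C
  rw [chamberSign]
  rcases lt_or_gt_of_ne (hne x hx) with h1 | h1 <;>
    rcases lt_or_gt_of_ne (hne _ hp) with h2 | h2
  · rw [sign_neg h1, sign_neg h2]
  · exact (hno _ hx _ hp h1 h2).elim
  · exact (hno _ hp _ hx h2 h1).elim
  · rw [sign_pos h1, sign_pos h2]

theorem connectedComponentIn_eq_of_sign {x y : EuclideanSpace ℝ (Fin d)} (hx : x ∈ A.complement)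
    (h : ∀ H, sign (A.form H x) = sign (A.form H y)) :
    connectedComponentIn A.complement x = connectedComponentIn A.complement y := by
  refine connectedComponentIn_eq ?_
  refine (convex_segment x y).isPreconnected.subset_connectedComponentIn
    (left_mem_segment ℝ _ _) ?_ (right_mem_segment ℝ _ _)
  rintro z ⟨a, b, ha, hb, hab, rfl⟩
  rw [mem_complement_iff] at hx ⊢
  intro H h0
  have h1 := hx H
  have h2 := h H
  have h3 : a * A.form H x + b * A.form H y = 0 := by simpa using sign_eq_zero_iff.1 h0
  have h4 : A.form H x ≠ 0 := fun h => h1 (sign_eq_zero_iff.2 h)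
  rcases lt_or_gt_of_ne h4 with h5 | h5
  · rw [sign_neg h5, eq_comm, sign_eq_neg_one_iff] at h2
    rcases ha.eq_or_lt with rfl | ha
    · obtain rfl : b = 1 := by linarith
      linarith
    · nlinarith [mul_neg_of_pos_of_neg ha h5, mul_nonneg hb (neg_nonneg.2 h2.le)]
  · rw [sign_pos h5, eq_comm, sign_eq_one_iff] at h2
    rcases ha.eq_or_lt with rfl | ha
    · obtain rfl : b = 1 := by linarith
      linarith
    · nlinarith [mul_pos ha h5, mul_nonneg hb h2.le]

theorem chamberSign_injective : Function.Injective A.chamberSign := by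
  intro C D h
  apply Subtype.ext
  rw [A.coe_chamber C, A.coe_chamber D]
  exact A.connectedComponentIn_eq_of_sign (A.point_mem_complement C) (congrFun h)

theorem chamberSign_mem_topes (C : A.chambers) : A.chamberSign C ∈ topes A.form Finset.univ :=
  mem_topes.2 ⟨⟨A.point C, fun _ _ => rfl⟩, by simp, fun H _ => A.chamberSign_ne_zero C H⟩

theorem exists_chamberSign_eq {F : A.hyperplanes → SignType}
    (hF : F ∈ topes A.form Finset.univ) : ∃ C, A.chamberSign C = F := by
  obtain ⟨⟨x, hx⟩, -, h1⟩ := mem_topes.1 hF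
  simp only [Finset.mem_univ, true_imp_iff] at hx h1
  have hxc : x ∈ A.complement := A.mem_complement_iff.2 fun H => by rw [hx]; exact h1 H
  refine ⟨⟨connectedComponentIn A.complement x, x, hxc, rfl⟩, funext fun H => ?_⟩
  rw [← hx H]
  exact (A.sign_form_of_mem (mem_connectedComponentIn hxc) H).symm

theorem separates_iff {C D : A.chambers} (H : A.hyperplanes) :
    Separates H.1 C.1 D.1 ↔ A.chamberSign C H ≠ A.chamberSign D H := by
  have hC := A.chamberSign_ne_zero C H
  have hD := A.chamberSign_ne_zero D H
  constructor
  · rintro ⟨α, hα, h1, h2⟩ heq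
    have hp := h1 _ (A.point_mem C)
    have hn := h2 _ (A.point_mem D)
    -- The form `α` need not be `A.form H`, but they share a kernel: this positive combination of
    -- the two points lies in `H`, which is impossible if `A.form H` has the same sign at both.
    have hz : α ((-α (A.point D)) • A.point C + α (A.point C) • A.point D) = 0 := by
      simp only [map_add, map_smul, smul_eq_mul]
      ring
    have hz' : (-α (A.point D)) * A.form H (A.point C) +
        α (A.point C) * A.form H (A.point D) = 0 := by
      rw [← LinearMap.mem_ker, hα, ← A.ker_form H, LinearMap.mem_ker] at hz
      simpa using hz
    have hn' : 0 < -α (A.point D) := neg_pos.2 hn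
    have hf : A.form H (A.point C) ≠ 0 := fun h => hC (sign_eq_zero_iff.2 h)
    rw [chamberSign, chamberSign] at heq
    rcases lt_or_gt_of_ne hf with h | h
    · rw [sign_neg h, eq_comm, sign_eq_neg_one_iff] at heq
      nlinarith [mul_neg_of_pos_of_neg hn' h, mul_neg_of_pos_of_neg hp heq]
    · rw [sign_pos h, eq_comm, sign_eq_one_iff] at heq
      nlinarith [mul_pos hn' h, mul_pos hp heq]
  · intro hne
    have key : ∀ C D : A.chambers, A.chamberSign C H = 1 → A.chamberSign D H = -1 →
        Separates H.1 C.1 D.1 := fun C D h1 h2 =>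
      ⟨A.form H, A.ker_form H,
        fun x hx => sign_eq_one_iff.1 ((A.sign_form_of_mem hx H).trans h1),
        fun x hx => sign_eq_neg_one_iff.1 ((A.sign_form_of_mem hx H).trans h2)⟩
    have hcases : ∀ a b : SignType, a ≠ 0 → b ≠ 0 → a ≠ b → (a = 1 ∧ b = -1) ∨ b = 1 ∧ a = -1 := by
      decide
    rcases hcases _ _ hC hD hne with h | h
    · exact key C D h.1 h.2
    · exact (key D C h.1 h.2).symm

theorem topeGraph_adj_iff {C D : A.chambers} :
    A.topeGraph.Adj C D ↔ signDist Finset.univ (A.chamberSign C) (A.chamberSign D) = 1 := by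
  change (∃ H, A.separating C D = {H}) ↔ _
  rw [signDist, Finset.card_eq_one]
  constructor
  · rintro ⟨H, hH⟩
    have hmem : H ∈ A.separating C D := by rw [hH]; rfl
    refine ⟨⟨H, hmem.1⟩, ?_⟩
    ext K
    simp only [Finset.mem_filter, Finset.mem_univ, true_and, Finset.mem_singleton]
    rw [← A.separates_iff K]
    have h1 : K.1 ∈ A.separating C D ↔ K.1 = H := by rw [hH]; rfl
    rw [Subtype.ext_iff, ← h1]
    exact ⟨fun h => ⟨K.2, h⟩, fun h => h.2⟩
  · rintro ⟨H, hH⟩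
    refine ⟨H.1, ?_⟩
    ext K
    have h1 : ∀ K : A.hyperplanes, A.chamberSign C K ≠ A.chamberSign D K ↔ K = H := fun K => by
      simpa using Finset.ext_iff.1 hH K
    constructor
    · rintro ⟨hK, h⟩
      exact congrArg Subtype.val ((h1 ⟨K, hK⟩).1 ((A.separates_iff ⟨K, hK⟩).1 h))
    · rintro rfl
      exact ⟨H.2, (A.separates_iff H).2 ((h1 H).2 rfl)⟩

theorem exists_walk_length_eq (C D : A.chambers) : ∃ p : A.topeGraph.Walk C D,
    p.length = signDist Finset.univ (A.chamberSign C) (A.chamberSign D) := by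
  induction hn : signDist Finset.univ (A.chamberSign C) (A.chamberSign D) generalizing C with
  | zero =>
    rw [signDist, Finset.card_eq_zero, Finset.filter_eq_empty_iff] at hn
    obtain rfl : C = D :=
      A.chamberSign_injective (funext fun k => not_not.1 (hn (Finset.mem_univ k)))
    exact ⟨SimpleGraph.Walk.nil, rfl⟩
  | succ n ih =>
    have hne : A.chamberSign C ≠ A.chamberSign D := by
      intro h
      rw [h, signDist_eq_zero fun _ _ => rfl] at hn
      omega
    obtain ⟨T, hT, h1, h2⟩ := exists_adjacent_tope A.ker_form_injective
      (A.chamberSign_mem_topes C) (A.chamberSign_mem_topes D) hne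
    obtain ⟨C', rfl⟩ := A.exists_chamberSign_eq hT
    obtain ⟨p, hp⟩ := ih C' (by omega)
    exact ⟨SimpleGraph.Walk.cons (A.topeGraph_adj_iff.2 h1) p, by simp [hp]⟩

theorem signDist_le_length {C D : A.chambers} (p : A.topeGraph.Walk C D) :
    signDist Finset.univ (A.chamberSign C) (A.chamberSign D) ≤ p.length := by
  induction p with
  | nil => rw [signDist_eq_zero fun _ _ => rfl]; exact Nat.zero_le _
  | @cons u v w h p ih =>
    rw [SimpleGraph.Walk.length_cons]
    refine (signDist_triangle _ _ (A.chamberSign v) _).trans ?_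
    rw [A.topeGraph_adj_iff.1 h]
    omega

theorem topeGraph_reachable (C D : A.chambers) : A.topeGraph.Reachable C D :=
  (A.exists_walk_length_eq C D).choose.reachable

/-- The distance in the tope graph is the number of separating hyperplanes. -/
theorem topeGraph_dist (C D : A.chambers) :
    A.topeGraph.dist C D = signDist Finset.univ (A.chamberSign C) (A.chamberSign D) := by
  refine le_antisymm ?_ ?_
  · obtain ⟨p, hp⟩ := A.exists_walk_length_eq C D
    exact hp ▸ SimpleGraph.dist_le p
  · obtain ⟨p, hp⟩ := (A.topeGraph_reachable C D).exists_walk_length_eq_dist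
    exact hp ▸ A.signDist_le_length p

theorem exists_antipode (C : A.chambers) : ∃ D, A.chamberSign D = -A.chamberSign C :=
  A.exists_chamberSign_eq (neg_mem_topes (A.chamberSign_mem_topes C))

/-- A real vector space is not a finite union of proper subspaces. Nonemptiness makes the magnitude
nonzero at q = 0. -/
instance nonempty_chambers : Nonempty A.chambers := by
  obtain ⟨x, hx⟩ : ∃ x, x ∈ A.complement := by
    have h := Subspace.biUnion_ne_univ_of_top_notMem (s := A.hyperplanes) fun h => by
      have := A.finrank_add_one _ h
      simp at this
    rw [Set.ne_univ_iff_exists_notMem] at h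
    obtain ⟨x, hx⟩ := h
    exact ⟨x, fun H hH hxH => hx (Set.mem_biUnion hH hxH)⟩
  exact ⟨⟨_, x, hx, rfl⟩⟩

end CentralArrangement
-- From the functional equation to palindromic polynomials.
section Palindromic

open Polynomial

theorem aeval_ratFuncX (f : ℚ[X]) :
    aeval (RatFunc.X : RatFunc ℚ) f = algebraMap ℚ[X] (RatFunc ℚ) f := by
  have h : (aeval (RatFunc.X : RatFunc ℚ)).toRingHom = algebraMap ℚ[X] (RatFunc ℚ) :=
    ringHom_ext' (Subsingleton.elim _ _) (by simp)
  exact RingHom.congr_fun h f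

theorem algebraMap_reverse_eq (f : ℚ[X]) :
    algebraMap ℚ[X] (RatFunc ℚ) f.reverse =
      (RatFunc.X : RatFunc ℚ) ^ f.natDegree * aeval (RatFunc.X : RatFunc ℚ)⁻¹ f := by
  have hX : (RatFunc.X : RatFunc ℚ) ≠ 0 := RatFunc.X_ne_zero
  let : Invertible (RatFunc.X : RatFunc ℚ)⁻¹ := invertibleOfNonzero (inv_ne_zero hX)
  have h := eval₂_reverse_mul_pow (algebraMap ℚ (RatFunc ℚ)) (RatFunc.X : RatFunc ℚ)⁻¹ f
  rw [invOf_eq_inv, inv_inv, ← aeval_def, ← aeval_def, aeval_ratFuncX] at h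
  rw [← h, mul_comm, mul_assoc, ← mul_pow, inv_mul_cancel₀ hX, one_pow, mul_one]

theorem aeval_inv_X_ne_zero {f : ℚ[X]} (hf : f ≠ 0) :
    aeval (RatFunc.X : RatFunc ℚ)⁻¹ f ≠ 0 := by
  intro h
  have h1 := algebraMap_reverse_eq f
  rw [h, mul_zero, FaithfulSMul.algebraMap_eq_zero_iff, reverse_eq_zero] at h1
  exact hf h1

/-- A reduced fraction `P / Q` with `P(1/X) / Q(1/X) = X ^ n * P / Q` and without zeros and poles
at `0` and poles at `1` has palindromic numerator and denominator. -/
theorem palindromic_of_functional_equation {P Q : ℚ[X]} {n : ℕ} (hPQ : IsCoprime P Q)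
    (hP0 : P.eval 0 ≠ 0) (hQ0 : Q.eval 0 ≠ 0) (hQ1 : Q.eval 1 ≠ 0)
    (h : (RatFunc.X : RatFunc ℚ) ^ n * algebraMap ℚ[X] (RatFunc ℚ) P *
        aeval (RatFunc.X : RatFunc ℚ)⁻¹ Q =
      aeval (RatFunc.X : RatFunc ℚ)⁻¹ P * algebraMap ℚ[X] (RatFunc ℚ) Q) :
    Q.natDegree = n + P.natDegree ∧ P.reverse = P ∧ Q.reverse = Q := by
  have hP : P ≠ 0 := fun h => hP0 (by simp [h])
  have hQ : Q ≠ 0 := fun h => hQ0 (by simp [h])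
  have hX : (RatFunc.X : RatFunc ℚ) ≠ 0 := RatFunc.X_ne_zero
  -- The functional equation times X ^ (deg P + deg Q), which clears the powers of 1 / X.
  have key : X ^ (n + P.natDegree) * P * Q.reverse = P.reverse * Q * X ^ Q.natDegree := by
    apply RatFunc.algebraMap_injective ℚ
    simp only [map_mul, map_pow, RatFunc.algebraMap_X, algebraMap_reverse_eq]
    linear_combination (RatFunc.X : RatFunc ℚ) ^ (P.natDegree + Q.natDegree) * h
  have hrdeg : ∀ f : ℚ[X], f.eval 0 ≠ 0 → f.reverse.natDegree = f.natDegree := by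
    intro f hf
    rw [reverse_natDegree, natTrailingDegree_eq_zero.2, Nat.sub_zero]
    right
    rwa [coeff_zero_eq_eval_zero]
  have hrP : P.reverse ≠ 0 := fun h => hP (reverse_eq_zero.1 h)
  have hrQ : Q.reverse ≠ 0 := fun h => hQ (reverse_eq_zero.1 h)
  have hXn : ∀ k, (X : ℚ[X]) ^ k ≠ 0 := fun k => pow_ne_zero _ X_ne_zero
  -- Reversal preserves the degree of a polynomial with nonzero constant term, so comparing degrees
  -- gives the first claim.
  have hdeg := congrArg natDegree key
  rw [natDegree_mul (mul_ne_zero (hXn _) hP) hrQ, natDegree_mul (hXn _) hP,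
    natDegree_mul (mul_ne_zero hrP hQ) (hXn _), natDegree_mul hrP hQ, natDegree_X_pow,
    natDegree_X_pow, hrdeg P hP0, hrdeg Q hQ0] at hdeg
  have hdeg' : Q.natDegree = n + P.natDegree := by omega
  have key' : P * Q.reverse = P.reverse * Q := by
    apply mul_left_cancel₀ (hXn Q.natDegree)
    rw [← hdeg'] at key
    linear_combination key
  have hdvd : Q ∣ Q.reverse := hPQ.symm.dvd_of_dvd_mul_left ⟨P.reverse, by rw [key', mul_comm]⟩
  have hQQ : Q.reverse = Q := by
    obtain ⟨c, hc⟩ := hdvd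
    have hc0 : c ≠ 0 := by
      rintro rfl
      exact hrQ (by rw [hc, mul_zero])
    have hcd := congrArg natDegree hc
    rw [natDegree_mul hQ hc0, hrdeg Q hQ0] at hcd
    obtain ⟨a, rfl⟩ := natDegree_eq_zero.1 (show c.natDegree = 0 by omega)
    -- Reversal preserves the value at 1; as `Q` does not vanish there, the constant relating
    -- `Q.reverse` to `Q` is 1 and the antipalindromic case is excluded.
    have h1 : Q.reverse.eval 1 = Q.eval 1 := by
      let : Invertible (1 : ℚ) := invertibleOne
      have h2 := eval₂_reverse_mul_pow (RingHom.id ℚ) (1 : ℚ) Q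
      simpa using h2
    rw [hc, eval_mul, eval_C] at h1
    have ha : a = 1 := mul_left_cancel₀ hQ1 (by rw [h1, mul_one])
    rw [hc, ha, C_1, mul_one]
  refine ⟨hdeg', ?_, hQQ⟩
  rw [hQQ] at key'
  exact (mul_right_cancel₀ hQ key').symm

end Palindromic

/-- Lower bound for the quadratic form of a Hamming distance matrix. -/
theorem pow_card_mul_sq_le {T ι : Type*} [Fintype T] [DecidableEq ι] {q : ℚ}
    (hq0 : 0 ≤ q) (hq1 : q ≤ 1)
    (f : T → ι → Prop) [∀ C i, Decidable (f C i)] (s : Finset ι) (v : T → ℚ) :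
    q ^ s.card * (∑ C, v C) ^ 2 ≤
      ∑ C, ∑ D, (∏ i ∈ s, if (f C i ↔ f D i) then 1 else q) * (v C * v D) := by
  induction s using Finset.induction_on generalizing v with
  | empty => simp [sq, Finset.sum_mul_sum]
  | insert i s hi ih =>
    have hnn : ∀ u : T → ℚ, 0 ≤
        ∑ C, ∑ D, (∏ i ∈ s, if (f C i ↔ f D i) then 1 else q) * (u C * u D) := fun u =>
      le_trans (by positivity) (ih u)
    have h1 := ih v
    have h2 := hnn fun C => if f C i then v C else 0
    have h3 := hnn fun C => if f C i then 0 else v C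
    -- The factor of `i` is q times the constant 1 plus (1 - q) times the indicator of lying on the
    -- same side of `i`. That indicator splits the form into two blocks, both nonnegative by
    -- induction.
    have h4 : ∑ C, ∑ D, (∏ i ∈ insert i s, if (f C i ↔ f D i) then 1 else q) * (v C * v D) =
        q * (∑ C, ∑ D, (∏ i ∈ s, if (f C i ↔ f D i) then 1 else q) * (v C * v D)) +
        (1 - q) * ((∑ C, ∑ D, (∏ i ∈ s, if (f C i ↔ f D i) then 1 else q) *
          ((if f C i then v C else 0) * (if f D i then v D else 0))) +
          ∑ C, ∑ D, (∏ i ∈ s, if (f C i ↔ f D i) then 1 else q) *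
          ((if f C i then 0 else v C) * (if f D i then 0 else v D))) := by
      simp only [← Finset.sum_add_distrib, Finset.mul_sum]
      refine Finset.sum_congr rfl fun C _ => Finset.sum_congr rfl fun D _ => ?_
      rw [Finset.prod_insert hi]
      by_cases hC : f C i <;> by_cases hD : f D i <;> 
        simp only [hC, hD, if_true, if_false, iff_true, iff_false, not_true] <;> ring
    rw [h4, Finset.card_insert_of_notMem hi, pow_succ]
    have h5 := mul_le_mul_of_nonneg_left h1 hq0
    have h6 := mul_nonneg (sub_nonneg.2 hq1) (add_nonneg h2 h3)
    linarith

/-! ### Determinant and adjugate of the distance matrix. -/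

section DistanceMatrix

open Polynomial Matrix

variable {T : Type*} [Fintype T] [DecidableEq T]

/-- The matrix of the monomials `X ^ δ C D`. -/
noncomputable def distMatrix (δ : T → T → ℕ) : Matrix T T ℚ[X] := of fun C D => X ^ δ C D

theorem map_distMatrix {K : Type*} [CommRing K] [Algebra ℚ K] (δ : T → T → ℕ) (q : K) :
    (aeval q).mapMatrix (distMatrix δ) = of fun C D => q ^ δ C D := by
  ext C D
  simp [distMatrix]

/-- The sum of the entries of the adjugate of the distance matrix. -/
noncomputable def sumAdjugate (δ : T → T → ℕ) : ℚ[X] := ∑ C, ∑ D, (distMatrix δ).adjugate C D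

theorem aeval_sumAdjugate {K : Type*} [CommRing K] [Algebra ℚ K] (δ : T → T → ℕ) (q : K) :
    aeval q (sumAdjugate δ) = ∑ C, ∑ D, (of fun C D => q ^ δ C D : Matrix T T K).adjugate C D := by
  rw [← map_distMatrix, ← AlgHom.map_adjugate, sumAdjugate]
  simp only [map_sum, AlgHom.mapMatrix_apply, Matrix.map_apply]

theorem aeval_det_distMatrix {K : Type*} [CommRing K] [Algebra ℚ K] (δ : T → T → ℕ) (q : K) :
    aeval q (distMatrix δ).det = (of fun C D => q ^ δ C D : Matrix T T K).det := by
  rw [AlgHom.map_det, map_distMatrix]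

/-- Multiply the weighting equation by the adjugate. No inverse is needed, so this applies at both
`RatFunc.X` and its inverse. -/
theorem aeval_det_mul_sum {K : Type*} [CommRing K] [Algebra ℚ K] {δ : T → T → ℕ} {q : K}
    {w : T → K} (hw : ∀ C, ∑ D, q ^ δ C D * w D = 1) :
    aeval q (distMatrix δ).det * ∑ C, w C = aeval q (sumAdjugate δ) := by
  rw [aeval_det_distMatrix, aeval_sumAdjugate]
  set N : Matrix T T K := of fun C D => q ^ δ C D with hN
  have h1 : N *ᵥ w = 1 := funext hw
  have h2 : N.adjugate *ᵥ (N *ᵥ w) = N.det • w := by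
    rw [mulVec_mulVec, adjugate_mul, smul_mulVec, one_mulVec]
  rw [h1] at h2
  rw [Finset.mul_sum]
  refine Finset.sum_congr rfl fun C _ => ?_
  have h3 := congrFun h2 C
  simp only [mulVec, dotProduct, Pi.one_apply, mul_one, Pi.smul_apply, smul_eq_mul] at h3
  exact h3.symm

theorem eval_zero_det_distMatrix {δ : T → T → ℕ} (hδ : ∀ C D, δ C D = 0 ↔ C = D) :
    (distMatrix δ).det.eval 0 = 1 := by
  rw [← coe_aeval_eq_eval, aeval_det_distMatrix]
  have h : (of fun C D => (0 : ℚ) ^ δ C D : Matrix T T ℚ) = 1 := by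
    ext C D
    simp [Matrix.one_apply, zero_pow_eq, hδ]
  rw [h, det_one]

theorem eval_zero_sumAdjugate {δ : T → T → ℕ} (hδ : ∀ C D, δ C D = 0 ↔ C = D) :
    (sumAdjugate δ).eval 0 = Fintype.card T := by
  rw [← coe_aeval_eq_eval, aeval_sumAdjugate]
  have h : (of fun C D => (0 : ℚ) ^ δ C D : Matrix T T ℚ) = 1 := by
    ext C D
    simp [Matrix.one_apply, zero_pow_eq, hδ]
  rw [h, adjugate_one]
  simp [Matrix.one_apply]

end DistanceMatrix
-- Absence of a pole at 1.
section Poles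

open Polynomial Matrix

/-- With S / D = P / Q, the inequality becomes q ^ n * P ^ 2 ≤ P * Q wherever D(q) ≠ 0. If Q(1) = 0,
then P(1) ≠ 0 by coprimality and the inequality fails on a whole interval to the left of 1, so D
would vanish there identically. -/
theorem eval_one_ne_zero_of_le {P Q S D : ℚ[X]} {n : ℕ} (hPQ : IsCoprime P Q) (hD : D ≠ 0)
    (h : S * Q = P * D)
    (hle : ∀ q : ℚ, 0 < q → q < 1 → q ^ n * S.eval q ^ 2 ≤ D.eval q * S.eval q) :
    Q.eval 1 ≠ 0 := by
  intro hQ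
  have hP : P.eval 1 ≠ 0 := by
    intro hP
    obtain ⟨a, b, hab⟩ := hPQ
    simpa [hP, hQ] using congrArg (eval 1) hab
  let g := P * Q - X ^ n * P ^ 2
  have hg1 : g.eval 1 < 0 := by
    have := pow_pos (abs_pos.2 hP) 2
    rw [sq_abs] at this
    simp [g, hQ]
    positivity
  have hev : ∀ᶠ q in nhdsWithin (1 : ℚ) (Set.Iio 1), g.eval q < 0 :=
    nhdsWithin_le_nhds (g.continuous.tendsto 1 (Iio_mem_nhds hg1))
  obtain ⟨a, ha, hsub⟩ := (mem_nhdsLT_iff_exists_Ioo_subset' (zero_lt_one' ℚ)).1 hev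
  have ha1 : max a 0 < 1 := max_lt ha zero_lt_one
  refine hD (eq_zero_of_infinite_isRoot D ((Set.Ioo_infinite ha1).mono fun q hq => ?_))
  have hq0 : 0 < q := (le_max_right a 0).trans_lt hq.1
  have hgq : g.eval q < 0 := hsub ⟨(le_max_left a 0).trans_lt hq.1, hq.2⟩
  have hSq : S.eval q * Q.eval q = P.eval q * D.eval q := by
    simpa using congrArg (eval q) h
  have h1 := mul_nonneg (sq_nonneg (Q.eval q)) (sub_nonneg.2 (hle q hq0 hq.2))
  have h2 : Q.eval q ^ 2 * (D.eval q * S.eval q - q ^ n * S.eval q ^ 2) =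
      D.eval q ^ 2 * g.eval q := by
    simp only [g, eval_sub, eval_mul, eval_pow, eval_X]
    linear_combination
      (D.eval q * Q.eval q - q ^ n * (S.eval q * Q.eval q + P.eval q * D.eval q)) * hSq
  rw [h2] at h1
  change D.eval q = 0
  by_contra hne
  have h3 : 0 < D.eval q ^ 2 := by positivity
  nlinarith [mul_neg_of_pos_of_neg h3 hgq]

end Poles

/-! ### Antipodes, the functional equation, and the location of the poles. -/

namespace CentralArrangement

open Polynomial Matrix SignType

variable {d : ℕ} (A : CentralArrangement d)

/-- The number of hyperplanes separating two chambers. -/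
noncomputable def chamberDist (C D : A.chambers) : ℕ :=
  signDist Finset.univ (A.chamberSign C) (A.chamberSign D)

theorem chamberDist_eq_zero (C D : A.chambers) : A.chamberDist C D = 0 ↔ C = D := by
  classical
  constructor
  · intro h
    rw [chamberDist, signDist, Finset.card_eq_zero, Finset.filter_eq_empty_iff] at h
    exact A.chamberSign_injective (funext fun k => not_not.1 (h (Finset.mem_univ k)))
  · rintro rfl
    exact signDist_eq_zero fun _ _ => rfl

/-- The chamber opposite to `C`. -/
noncomputable def antipode (C : A.chambers) : A.chambers := (A.exists_antipode C).choose

theorem chamberSign_antipode (C : A.chambers) :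
    A.chamberSign (A.antipode C) = -A.chamberSign C :=
  (A.exists_antipode C).choose_spec

theorem antipode_involutive : Function.Involutive A.antipode := fun C =>
  A.chamberSign_injective (by rw [chamberSign_antipode, chamberSign_antipode, neg_neg])

/-- Every chamber `D` lies between `C` and its antipode, from which all hyperplanes separate it. -/
theorem chamberDist_add_antipode (C D : A.chambers) :
    A.chamberDist C D + A.chamberDist C (A.antipode D) = A.hyperplanes.card := by
  have h : A.chamberDist C (A.antipode D) = A.chamberDist D (A.antipode C) := by
    classical
    unfold chamberDist signDist
    congr 1
    refine Finset.filter_congr fun j _ => ?_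
    rw [chamberSign_antipode, chamberSign_antipode, Pi.neg_apply, Pi.neg_apply]
    generalize A.chamberSign C j = a
    generalize A.chamberSign D j = b
    revert a b
    decide
  rw [h, chamberDist, chamberDist, signDist_add_of_between, signDist_eq_card]
  · simp
  · intro j _
    rw [chamberSign_antipode, Pi.neg_apply]
    exact (by decide : ∀ a : SignType, a ≠ 0 → a ≠ -a) _ (A.chamberSign_ne_zero C j)
  · intro j _
    rw [chamberSign_antipode, Pi.neg_apply]
    exact (by decide : ∀ a b : SignType, a ≠ 0 → b ≠ 0 → b = a ∨ b = -a) _ _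
      (A.chamberSign_ne_zero C j) (A.chamberSign_ne_zero D j)

theorem zetaMatrix_topeGraph :
    A.topeGraph.zetaMatrix = of fun C D => (RatFunc.X : RatFunc ℚ) ^ A.chamberDist C D := by
  ext C D
  simp only [SimpleGraph.zetaMatrix, of_apply]
  rw [if_pos (A.topeGraph_reachable C D), A.topeGraph_dist C D, chamberDist]

theorem prod_eq_pow_chamberDist (q : ℚ) (C D : A.chambers) :
    (∏ H : A.hyperplanes, if (A.chamberSign C H = 1 ↔ A.chamberSign D H = 1) then 1 else q) =
      q ^ A.chamberDist C D := by
  classical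
  rw [Finset.prod_ite, Finset.prod_const_one, one_mul, Finset.prod_const, chamberDist, signDist]
  congr 2
  refine Finset.filter_congr fun H _ => ?_
  exact (by decide : ∀ a b : SignType, a ≠ 0 → b ≠ 0 → (¬ (a = 1 ↔ b = 1) ↔ a ≠ b)) _ _
    (A.chamberSign_ne_zero C H) (A.chamberSign_ne_zero D H)

section Determinant

variable [DecidableEq A.chambers]

theorem det_distMatrix_ne_zero : (distMatrix A.chamberDist).det ≠ 0 := by
  intro h
  have h1 := eval_zero_det_distMatrix A.chamberDist_eq_zero
  rw [h] at h1
  simp at h1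

/-- The weighting of the tope graph. -/
theorem exists_weighting : ∃ w : A.chambers → RatFunc ℚ,
    (∀ C, ∑ D, (RatFunc.X : RatFunc ℚ) ^ A.chamberDist C D * w D = 1) ∧
      ∑ C, w C = A.magnitude := by
  classical
  set Z : Matrix A.chambers A.chambers (RatFunc ℚ) :=
    of fun C D => (RatFunc.X : RatFunc ℚ) ^ A.chamberDist C D with hZ
  have hdet : IsUnit Z.det := by
    rw [isUnit_iff_ne_zero, hZ, ← aeval_det_distMatrix, aeval_ratFuncX,
      Ne, FaithfulSMul.algebraMap_eq_zero_iff]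
    exact A.det_distMatrix_ne_zero
  refine ⟨fun C => ∑ D, Z⁻¹ C D, fun C => ?_, ?_⟩
  · have h1 : (Z *ᵥ (Z⁻¹ *ᵥ 1)) C = 1 := by
      rw [mulVec_mulVec, mul_nonsing_inv _ hdet, one_mulVec, Pi.one_apply]
    simpa [mulVec, dotProduct, hZ] using h1
  · rw [magnitude, SimpleGraph.magnitude, zetaMatrix_topeGraph]
    refine Finset.sum_congr rfl fun C _ => Finset.sum_congr rfl fun D _ => ?_
    congr!

/-- The functional equation of the magnitude. -/
theorem aeval_inv_det_mul_magnitude :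
    aeval (RatFunc.X : RatFunc ℚ)⁻¹ (distMatrix A.chamberDist).det *
        (RatFunc.X ^ A.hyperplanes.card * A.magnitude) =
      aeval (RatFunc.X : RatFunc ℚ)⁻¹ (sumAdjugate A.chamberDist) := by
  obtain ⟨w, hw, hsum⟩ := A.exists_weighting
  have hX : (RatFunc.X : RatFunc ℚ) ≠ 0 := RatFunc.X_ne_zero
  let e : Equiv.Perm A.chambers := A.antipode_involutive.toPerm
  -- Since X ^ (-d(C, D)) * X ^ n = X ^ d(C, -D), moving the weighting to antipodes and scaling by X
  -- ^ n gives a weighting at 1 / X.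
  have h := aeval_det_mul_sum (δ := A.chamberDist) (q := (RatFunc.X : RatFunc ℚ)⁻¹)
    (w := fun C => RatFunc.X ^ A.hyperplanes.card * w (e C)) fun C => ?_
  · rw [← h, ← Finset.mul_sum, Equiv.sum_comp e w, hsum]
  · refine Eq.trans ?_ ((Equiv.sum_comp e fun D =>
      (RatFunc.X : RatFunc ℚ) ^ A.chamberDist C D * w D).trans (hw C))
    refine Finset.sum_congr rfl fun D _ => ?_
    rw [← A.chamberDist_add_antipode C D, pow_add, inv_pow, mul_assoc, ← mul_assoc,
      inv_mul_cancel₀ (pow_ne_zero _ hX), one_mul]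
    rfl

/-- Apply the quadratic form bound to v = adj(N) 1: its entries sum to the sum of the adjugate, and
N v = det(N) 1. Using the adjugate avoids assuming that N is invertible at q. -/
theorem pow_card_mul_sumAdjugate_sq_le (q : ℚ) (hq0 : 0 < q) (hq1 : q < 1) :
    q ^ A.hyperplanes.card * (sumAdjugate A.chamberDist).eval q ^ 2 ≤
      (distMatrix A.chamberDist).det.eval q * (sumAdjugate A.chamberDist).eval q := by
  rw [← coe_aeval_eq_eval, aeval_det_distMatrix, aeval_sumAdjugate]
  set N : Matrix A.chambers A.chambers ℚ := of fun C D => q ^ A.chamberDist C D with hN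
  let v := N.adjugate *ᵥ 1
  have hv : ∀ C, ∑ D, N.adjugate C D = v C := fun C => by simp [v, mulVec, dotProduct]
  have hNv : ∀ C, ∑ D, q ^ A.chamberDist C D * v D = N.det := fun C => by
    have h : (N *ᵥ v) C = N.det := by
      simp only [v]
      rw [mulVec_mulVec, mul_adjugate, smul_mulVec, one_mulVec]
      simp
    exact h
  simp only [hv]
  have h := pow_card_mul_sq_le hq0.le hq1.le
    (fun (C : A.chambers) (H : A.hyperplanes) => A.chamberSign C H = 1) Finset.univ v
  rw [Finset.card_univ, Fintype.card_coe] at h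
  refine h.trans_eq ?_
  rw [Finset.mul_sum]
  refine Finset.sum_congr rfl fun C _ => ?_
  rw [← hNv C, Finset.sum_mul]
  refine Finset.sum_congr rfl fun D _ => ?_
  rw [prod_eq_pow_chamberDist]
  ring

theorem exists_pow_eq_one_of_det_eq_zero {z : ℂ}
    (hz : aeval z (distMatrix A.chamberDist).det = 0) : ∃ n : ℕ, 0 < n ∧ z ^ n = 1 := by
  classical
  by_contra! hroot
  rw [aeval_det_distMatrix] at hz
  obtain ⟨v, hv0, hv⟩ := exists_mulVec_eq_zero_iff.2 hz
  have himage : topes A.form Finset.univ = Finset.univ.image A.chamberSign := by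
    ext F
    simp only [Finset.mem_image, Finset.mem_univ, true_and]
    exact ⟨A.exists_chamberSign_eq, by rintro ⟨C, rfl⟩; exact A.chamberSign_mem_topes C⟩
  refine hv0 (funext fun C => ?_)
  have h := eq_zero_of_sum_signDist_eq_zero hroot A.form Finset.univ
    (Function.extend A.chamberSign v 0) ?_ _ (A.chamberSign_mem_topes C)
  · rwa [A.chamberSign_injective.extend_apply] at h
  · intro F hF
    obtain ⟨C, rfl⟩ := A.exists_chamberSign_eq hF
    rw [himage, Finset.sum_image fun C _ D _ h => A.chamberSign_injective h]
    simp only [A.chamberSign_injective.extend_apply]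
    exact congrFun hv C

end Determinant

end CentralArrangement

/-! ### Assembly of the three claims. -/

theorem theorem3 (d : ℕ) (A : CentralArrangement d) (P Q : Polynomial ℚ)
    (hred : IsCoprime P Q) (hlead : 0 < Q.leadingCoeff)
    (hmag : A.magnitude =
      algebraMap (Polynomial ℚ) (RatFunc ℚ) P / algebraMap (Polynomial ℚ) (RatFunc ℚ) Q) :
    P ≠ 0 ∧
    (A.hyperplanes.card : ℤ) = (Q.natDegree : ℤ) - (P.natDegree : ℤ) ∧
    (P.reverse = P ∧ Q.reverse = Q) ∧
    (∀ z : ℂ, Polynomial.aeval z Q = 0 → z ≠ 1 ∧ ∃ n : ℕ, 0 < n ∧ z ^ n = 1) := by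
  classical
  have hQ : Q ≠ 0 := Polynomial.leadingCoeff_ne_zero.1 hlead.ne'
  have hQ' : algebraMap (Polynomial ℚ) (RatFunc ℚ) Q ≠ 0 :=
    (FaithfulSMul.algebraMap_eq_zero_iff _ _).not.2 hQ
  set D := (distMatrix A.chamberDist).det with hD
  set S := sumAdjugate A.chamberDist with hS
  have hD0 : D ≠ 0 := A.det_distMatrix_ne_zero
  have hSQ : S * Q = P * D := by
    obtain ⟨w, hw, hsum⟩ := A.exists_weighting
    have h := aeval_det_mul_sum hw
    rw [hsum, hmag, aeval_ratFuncX, aeval_ratFuncX, mul_div_assoc', div_eq_iff hQ'] at h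
    apply RatFunc.algebraMap_injective ℚ
    rw [map_mul, map_mul, mul_comm (algebraMap _ _ P)]
    exact h.symm
  have hdvd : Q ∣ D := hred.symm.dvd_of_dvd_mul_left ⟨S, by rw [← hSQ, mul_comm]⟩
  have hDe : D.eval 0 = 1 := eval_zero_det_distMatrix A.chamberDist_eq_zero
  have hQ0 : Q.eval 0 ≠ 0 := by
    intro h
    obtain ⟨c, hc⟩ := hdvd
    rw [hc, Polynomial.eval_mul, h, zero_mul] at hDe
    exact zero_ne_one hDe
  have hP0 : P.eval 0 ≠ 0 := by
    intro h
    have h1 := congrArg (Polynomial.eval 0) hSQ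
    rw [Polynomial.eval_mul, Polynomial.eval_mul, h, zero_mul, hS,
      eval_zero_sumAdjugate A.chamberDist_eq_zero] at h1
    rcases mul_eq_zero.1 h1 with h2 | h2
    · exact Fintype.card_ne_zero (Nat.cast_eq_zero.1 h2)
    · exact hQ0 h2
  have hQ1 : Q.eval 1 ≠ 0 :=
    eval_one_ne_zero_of_le hred hD0 hSQ A.pow_card_mul_sumAdjugate_sq_le
  have hfun : (RatFunc.X : RatFunc ℚ) ^ A.hyperplanes.card *
      algebraMap (Polynomial ℚ) (RatFunc ℚ) P * Polynomial.aeval (RatFunc.X : RatFunc ℚ)⁻¹ Q =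
      Polynomial.aeval (RatFunc.X : RatFunc ℚ)⁻¹ P * algebraMap (Polynomial ℚ) (RatFunc ℚ) Q := by
    have h1 := A.aeval_inv_det_mul_magnitude
    have h2 := congrArg (Polynomial.aeval (RatFunc.X : RatFunc ℚ)⁻¹) hSQ
    rw [map_mul, map_mul, hS, ← h1, hmag] at h2
    apply mul_left_cancel₀ (aeval_inv_X_ne_zero hD0)
    have h3 := div_mul_cancel₀ (algebraMap (Polynomial ℚ) (RatFunc ℚ) P) hQ'
    rw [← hD] at h2
    generalize algebraMap (Polynomial ℚ) (RatFunc ℚ) P / algebraMap (Polynomial ℚ) (RatFunc ℚ) Q =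
      m at h2 h3
    linear_combination algebraMap (Polynomial ℚ) (RatFunc ℚ) Q * h2 -
      Polynomial.aeval (RatFunc.X : RatFunc ℚ)⁻¹ D * RatFunc.X ^ A.hyperplanes.card *
      Polynomial.aeval (RatFunc.X : RatFunc ℚ)⁻¹ Q * h3
  obtain ⟨hdeg, hrevP, hrevQ⟩ := palindromic_of_functional_equation hred hP0 hQ0 hQ1 hfun
  refine ⟨fun h => hP0 (by simp [h]), by omega, ⟨hrevP, hrevQ⟩, fun z hz => ⟨?_, ?_⟩⟩
  · rintro rfl
    rw [← map_one (algebraMap ℚ ℂ), Polynomial.aeval_algebraMap_apply,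
      FaithfulSMul.algebraMap_eq_zero_iff, Polynomial.coe_aeval_eq_eval] at hz
    exact hQ1 hz
  · refine A.exists_pow_eq_one_of_det_eq_zero ?_
    obtain ⟨c, hc⟩ := hdvd
    rw [← hD, hc, map_mul, hz, zero_mul]
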